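/- Let $0\le m\le n$ and $r\ge 0$ be integers. Let $a_j,b_{jk},f_j:[0,1]\times\mathbb R\to\mathbb R$ $(1\le j,k\le n)$ be $C^\infty$ (up to the boundary) and $2\pi$-periodic in $t$, and let $h_j:\mathbb R^n\to\mathbb R$ be $C^\infty$. On the strip consider the problem $$\partial_tu_j+a_j\partial_xu_j+\sum_{k=1}^nb_{jk}u_k=f_j\quad(1\le j\le n),\qquad u(x,t+2\pi)=u(x,t),$$ $$u_j(0,t)=h_j(z(t))\ \ (1\le j\le m),\qquad u_j(1,t)=h_j(z(t))\ \ (m<j\le n),$$ where $z(t)=(u_1(1,t),\dots,u_m(1,t),u_{m+1}(0,t),\dots,u_n(0,t))$. Assume that * $a_j>0$ for $j\le m$, $a_j<0$ for $j>m$, and $\inf_{[0,1]\times\mathbb R}|a_j|>0$ for all $j$; * for all $j\ne k$ there is $p_{jk}\in C^1([0,1]\times\mathbb R)$ such that $b_{jk}=p_{jk}(a_k-a_j)$, and $p_{jk}=0$ in the interior of $\{(x,t)\in[0,1]\times\mathbb R: a_j(x,t)=a_k(x,t)\}$. Let $x_j=0$ for $j\le m$ and $x_j=1$ for $j>m$.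 For $(x,t)\in[0,1]\times\mathbb R$ let $\xi\in[0,1]\mapsto\omega_j(\xi;x,t)$ be the solution of $\partial_\xi\omega_j(\xi;x,t)=1/a_j(\xi,\omega_j(\xi;x,t))$, $\omega_j(x;x,t)=t$, and put $$c_j(\xi,x,t)=\exp\int_x^\xi\Bigl(\frac{b_{jj}}{a_j}\Bigr)(\eta,\omega_j(\eta;x,t))\,d\eta,\qquad d_j(\xi,x,t)=\frac{c_j(\xi,x,t)}{a_j(\xi,\omega_j(\xi;x,t))}.$$ A continuous solution of the problem is a continuous function $u:[0,1]\times\mathbb R\to\mathbb R^n$, $2\pi$-periodic in $t$, such that for all $j\le n$ and $(x,t)\in[0,1]\times\mathbb R$ $$u_j(x,t)=c_j(x_j,x,t)\,h_j\bigl(z(\omega_j(x_j;x,t))\bigr)-\int_{x_j}^xd_j(\xi,x,t)\sum_{k\ne j}(b_{jk}u_k)(\xi,\omega_j(\xi;x,t))\,d\xi+\int_{x_j}^xd_j(\xi,x,t)f_j(\xi,\omega_j(\xi;x,t))\,d\xi .$$ If $$\exp\Bigl\{\int_x^{x_j}\Bigl(\frac{b_{jj}}{a_j}-l\,\frac{\partial_ta_j}{a_j^2}\Bigr)(\eta,\omega_j(\eta;x,t))\,d\eta\Bigr\}\sum_{k=1}^n|\partial_kh_j(z)|<1$$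 for all $j\le n$, $x\in[0,1]$, $t\in\mathbb R$, $z\in\mathbb R^n$ and $l=0,1,\dots,r$, then every continuous solution of the problem is of class $C^r$ on the strip $[0,1]\times\mathbb R$ (up to the boundary). -/

import Mathlib

open scoped ContDiff

noncomputable section

namespace DissipativeHyperbolic

/-- The closed strip `[0,1] × ℝ` of points `(x, t)`. -/
def strip : Set (ℝ × ℝ) := Set.Icc (0 : ℝ) 1 ×ˢ Set.univ

/-- Smoothness of a scalar function on the closed strip, up to the boundary. -/
def SmoothOnStrip (g : ℝ × ℝ → ℝ) : Prop := ContDiffOn ℝ ∞ g strip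

/-- `2π`-periodicity in `t` on the closed strip. -/
def PeriodicInTime {E : Type*} (g : ℝ × ℝ → E) : Prop :=
  ∀ x ∈ Set.Icc (0 : ℝ) 1, ∀ t : ℝ, g (x, t + 2 * Real.pi) = g (x, t)

/-- The partial derivative with respect to `t`. -/
def dt (g : ℝ × ℝ → ℝ) (q : ℝ × ℝ) : ℝ := deriv (fun s => g (q.1, s)) q.2

/-- The first `m` speeds are positive, the other ones are negative. -/
def SignCondition {n : ℕ} (m : ℕ) (a : Fin n → ℝ × ℝ → ℝ) : Prop :=
  ∀ j : Fin n, ∀ q ∈ strip, ((j : ℕ) < m → 0 < a j q) ∧ (m ≤ (j : ℕ) → a j q < 0)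

/-- The infimum of every `|a j|` over the closed strip is positive. -/
def NonDegenerate {n : ℕ} (a : Fin n → ℝ × ℝ → ℝ) : Prop :=
  ∀ j : Fin n, ∃ δ : ℝ, 0 < δ ∧ ∀ q ∈ strip, δ ≤ |a j q|

/-- The Levy-type condition on the off-diagonal lower-order coefficients. -/
def LevyCondition {n : ℕ} (a : Fin n → ℝ × ℝ → ℝ) (b : Fin n → Fin n → ℝ × ℝ → ℝ) : Prop :=
  ∀ j k : Fin n, j ≠ k → ∃ p : ℝ × ℝ → ℝ, ContDiffOn ℝ 1 p strip ∧
    (∀ q ∈ strip, b j k q = p q * (a k q - a j q)) ∧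
    (∀ q ∈ interior {q : ℝ × ℝ | q ∈ strip ∧ a j q = a k q}, p q = 0)

/-- `w : [0,1] → ℝ` is the characteristic of `∂ₜ + α ∂ₓ` through `(x, t)`, parametrized by the
space variable: `w' (ξ) = 1 / α (ξ, w ξ)` on `[0,1]` and `w x = t`. -/
def IsCharacteristic (α : ℝ × ℝ → ℝ) (x t : ℝ) (w : ℝ → ℝ) : Prop :=
  w x = t ∧ ∀ ξ ∈ Set.Icc (0 : ℝ) 1, HasDerivWithinAt w (1 / α (ξ, w ξ)) (Set.Icc 0 1) ξ

open Classical in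
/-- The characteristic `ξ ↦ ω(ξ; x, t)`, that is, the solution of the initial value problem in
`IsCharacteristic`. For `x ∈ [0,1]` and a smooth, `2π`-periodic `α` without zeros in the strip it
exists and is unique on `[0,1]`; where there is none, the value is the dummy `t`. -/
def omega (α : ℝ × ℝ → ℝ) (ξ x t : ℝ) : ℝ :=
  if hw : ∃ w, IsCharacteristic α x t w then hw.choose ξ else t

/-- The abscissa `x_j` of the boundary point from which the `j`-th characteristic enters the strip
(the end point with the smaller time): `0` for the first `m` (right-moving) components and `1` for
the other (left-moving) ones. -/
def entry {n : ℕ} (m : ℕ) (j : Fin n) : ℝ := if (j : ℕ) < m then 0 else 1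

/-- The weight `c_j(ξ, x, t) = exp ∫_x^ξ (b_jj / a_j)(η, ω_j(η; x, t)) dη`. -/
def c {n : ℕ} (a : Fin n → ℝ × ℝ → ℝ) (b : Fin n → Fin n → ℝ × ℝ → ℝ) (j : Fin n)
    (ξ x t : ℝ) : ℝ :=
  Real.exp (∫ η in x..ξ, b j j (η, omega (a j) η x t) / a j (η, omega (a j) η x t))

/-- The weight `d_j(ξ, x, t) = c_j(ξ, x, t) / a_j(ξ, ω_j(ξ; x, t))`. -/
def d {n : ℕ} (a : Fin n → ℝ × ℝ → ℝ) (b : Fin n → Fin n → ℝ × ℝ → ℝ) (j : Fin n)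
    (ξ x t : ℝ) : ℝ :=
  c a b j ξ x t / a j (ξ, omega (a j) ξ x t)

/-- The outgoing traces `z(t) = (u_1(1,t), …, u_m(1,t), u_{m+1}(0,t), …, u_n(0,t))`. -/
def outgoing {n : ℕ} (m : ℕ) (u : ℝ × ℝ → Fin n → ℝ) (t : ℝ) : Fin n → ℝ :=
  fun k => if (k : ℕ) < m then u (1, t) k else u (0, t) k

/-- Continuous solutions in the closed strip of `(∂ₜ + a ∂ₓ + b) u = f` with the reflection
boundary conditions `u_j(x_j, t) = h_j(z(t))`: the continuous functions that satisfy the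
system integrated along the characteristics, with the boundary conditions substituted. -/
def IsContinuousSolution {n : ℕ} (m : ℕ) (a : Fin n → ℝ × ℝ → ℝ)
    (b : Fin n → Fin n → ℝ × ℝ → ℝ) (f : Fin n → ℝ × ℝ → ℝ) (h : Fin n → (Fin n → ℝ) → ℝ)
    (u : ℝ × ℝ → Fin n → ℝ) : Prop :=
  ContinuousOn u strip ∧
  ∀ j : Fin n, ∀ x ∈ Set.Icc (0 : ℝ) 1, ∀ t : ℝ,
    u (x, t) j =
      c a b j (entry m j) x t * h j (outgoing m u (omega (a j) (entry m j) x t))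
      - (∫ ξ in (entry m j)..x, d a b j ξ x t *
          ∑ k ∈ Finset.univ.erase j,
            b j k (ξ, omega (a j) ξ x t) * u (ξ, omega (a j) ξ x t) k)
      + ∫ ξ in (entry m j)..x, d a b j ξ x t * f j (ξ, omega (a j) ξ x t)

/-- The contraction condition of order `l`:
`exp {∫_x^{x_j} (b_jj / a_j - l ∂ₜa_j / a_j²)(η, ω_j(η; x, t)) dη} ∑_k |∂_k h_j(z)| < 1`
for all `j`, all `(x, t)` in the closed strip and all `z ∈ ℝⁿ`. -/
def Contraction {n : ℕ} (m : ℕ) (a : Fin n → ℝ × ℝ → ℝ)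
    (b : Fin n → Fin n → ℝ × ℝ → ℝ) (h : Fin n → (Fin n → ℝ) → ℝ) (l : ℕ) : Prop :=
  ∀ j : Fin n, ∀ x ∈ Set.Icc (0 : ℝ) 1, ∀ t : ℝ, ∀ z : Fin n → ℝ,
    Real.exp (∫ η in x..(entry m j),
        (b j j (η, omega (a j) η x t) / a j (η, omega (a j) η x t)
          - (l : ℝ) * (dt (a j) (η, omega (a j) η x t) / a j (η, omega (a j) η x t) ^ 2)))
      * ∑ k : Fin n, |fderiv ℝ (h j) z (Pi.single k 1)| < 1

end DissipativeHyperbolic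

end

/-!
Divided by the speeds `a_j`, the system reads `∂ₓ v_j + F_j ∂ₜ v_j + ∑ β_jk v_k = G_j` with
`F_j = 1 / a_j`, and the Levy condition becomes `β_jk = p_jk (F_j - F_k)` for `j ≠ k`, with `p_jk`
of class `C¹`. A solution satisfies it along the characteristics `dt/dx = F_j`. Time
differentiation yields a system of the same kind for `∂ₜ v`: the diagonal coefficient becomes
`β_jj + ∂ₜ F_j`, so that the contraction conditions of orders `1, …, r` for `v` are the ones of orders
`0, …, r - 1` for `∂ₜ v`; the boundary condition becomes affine with the same linear part (this is why
boundary operators `Φ_j(t, z)` with explicit time dependence are admitted); the off-diagonal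
coefficients stay the same. By induction on the order (`IsDissipativeSolution.contDiffOn`, with
`IsDissipativeSolution.dt`), all reduces to the claim that a continuous solution has a continuous time
derivative if the contraction conditions of orders `0` and `1` hold (`IsDissipativeSolution.timeC1`).

For that claim, integrate along the characteristics. The component `v_j` is the propagated boundary
value `Φ_j(s, z(s))` plus integrals of `G_j` and of the coupling terms
`p_jk (F_j - F_k) v_k`, `k ≠ j`, over a characteristic of `F_j`. Although `v_k` is merely continuous,
the coupling integrals have a time derivative (`exists_timeC1_integral_coupling`): `v_k` is
differentiable along the characteristics of `F_k`. In the coordinates `(ξ, σ)` in which these are the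
lines `σ = const`, a characteristic of `F_j` is a curve `σ = θ(ξ, s)`, and `∂_ξ θ` contains the factor
`F_j - F_k`. Thus the integrand is the `ξ`-derivative of a `σ`-primitive along the curve, up to
terms without the factor `∂_ξ θ`, and integration by parts removes the need to differentiate `v_k`
(`hasDerivAt_integral_transversal`).

At the exit ends this gives `z_j(t) = Ψ_j(t, z(σ_j(t)))` with `C¹` functions `Ψ_j` and `σ_j`. The
contraction condition of order `0` says that the right-hand side is a contraction, the one of order
`1` that the linear equation for the derivative of `z` has this property, too. Hence the Picard
iterates and their derivatives converge uniformly, and `z` is `C¹` (`contDiff_one_of_functional_eq`).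
-/

noncomputable section

namespace DissipativeHyperbolic

open Set Filter Topology MeasureTheory

/-! ### Clamping the space variable, continuous time derivatives -/

/-- The projection of `ℝ` onto `[0,1]`. Functions on the strip are extended to the plane by
precomposing the space variable with it; they then are continuous everywhere. -/
def clamp (x : ℝ) : ℝ := max 0 (min 1 x)

@[fun_prop]
theorem continuous_clamp : Continuous clamp := by unfold clamp; fun_prop

theorem clamp_mem (x : ℝ) : clamp x ∈ Icc (0 : ℝ) 1 :=
  ⟨le_max_left _ _, max_le zero_le_one (min_le_left _ _)⟩

theorem clamp_of_mem {x : ℝ} (hx : x ∈ Icc (0 : ℝ) 1) : clamp x = x := by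
  rw [clamp, min_eq_right hx.2, max_eq_right hx.1]

@[simp] theorem clamp_clamp (x : ℝ) : clamp (clamp x) = clamp x := clamp_of_mem (clamp_mem x)

theorem uIcc_subset_unit {x y : ℝ} (hx : x ∈ Icc (0 : ℝ) 1) (hy : y ∈ Icc (0 : ℝ) 1) :
    uIcc x y ⊆ Icc (0 : ℝ) 1 := fun _ h => ⟨(le_inf hx.1 hy.1).trans h.1, h.2.trans (sup_le hx.2 hy.2)⟩

theorem Ioo_min_max_subset_unit {x y : ℝ} (hx : x ∈ Icc (0 : ℝ) 1) (hy : y ∈ Icc (0 : ℝ) 1) :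
    Ioo (min x y) (max x y) ⊆ Ioo (0 : ℝ) 1 :=
  fun _ h => ⟨(le_min hx.1 hy.1).trans_lt h.1, h.2.trans_le (max_le hx.2 hy.2)⟩

/-- `g` is continuous on the plane and has the continuous partial derivative `g'` in the second
variable, the time. -/
structure TimeC1 (g g' : ℝ × ℝ → ℝ) : Prop where
  cont : Continuous g
  cont' : Continuous g'
  hasDerivAt : ∀ x t, HasDerivAt (fun s => g (x, s)) (g' (x, t)) t

namespace TimeC1

variable {g g' k k' : ℝ × ℝ → ℝ}

theorem add (hg : TimeC1 g g') (hk : TimeC1 k k') :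
    TimeC1 (fun q => g q + k q) (fun q => g' q + k' q) :=
  ⟨hg.cont.add hk.cont, hg.cont'.add hk.cont', fun x t => (hg.hasDerivAt x t).add (hk.hasDerivAt x t)⟩

theorem sub (hg : TimeC1 g g') (hk : TimeC1 k k') :
    TimeC1 (fun q => g q - k q) (fun q => g' q - k' q) :=
  ⟨hg.cont.sub hk.cont, hg.cont'.sub hk.cont', fun x t => (hg.hasDerivAt x t).sub (hk.hasDerivAt x t)⟩

theorem mul (hg : TimeC1 g g') (hk : TimeC1 k k') :
    TimeC1 (fun q => g q * k q) (fun q => g' q * k q + g q * k' q) :=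
  ⟨hg.cont.mul hk.cont, (hg.cont'.mul hk.cont).add (hg.cont.mul hk.cont'),
    fun x t => (hg.hasDerivAt x t).mul (hk.hasDerivAt x t)⟩

theorem neg (hg : TimeC1 g g') : TimeC1 (fun q => -g q) (fun q => -g' q) :=
  ⟨hg.cont.neg, hg.cont'.neg, fun x t => (hg.hasDerivAt x t).neg⟩

theorem exp (hg : TimeC1 g g') :
    TimeC1 (fun q => Real.exp (g q)) (fun q => Real.exp (g q) * g' q) :=
  ⟨hg.cont.rexp, hg.cont.rexp.mul hg.cont', fun x t => (hg.hasDerivAt x t).exp⟩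

theorem sum {ι : Type*} {s : Finset ι} {G G' : ι → ℝ × ℝ → ℝ}
    (h : ∀ i ∈ s, TimeC1 (G i) (G' i)) :
    TimeC1 (fun q => ∑ i ∈ s, G i q) (fun q => ∑ i ∈ s, G' i q) :=
  ⟨continuous_finsetSum _ fun i hi => (h i hi).cont,
    continuous_finsetSum _ fun i hi => (h i hi).cont',
    fun x t => HasDerivAt.fun_sum fun i hi => (h i hi).hasDerivAt x t⟩

theorem congr (hg : TimeC1 g g') (h : ∀ q, k q = g q) : TimeC1 k g' := by
  rwa [show k = g from funext h]

/-- Substitution of a time-differentiable function for the time. -/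
theorem comp (hg : TimeC1 g g') (hk : TimeC1 k k') :
    TimeC1 (fun q => g (q.1, k q)) (fun q => g' (q.1, k q) * k' q) :=
  ⟨hg.cont.comp (continuous_fst.prodMk hk.cont),
    (hg.cont'.comp (continuous_fst.prodMk hk.cont)).mul hk.cont',
    fun x t => HasDerivAt.comp (h₂ := fun s => g (x, s)) t (hg.hasDerivAt x (k (x, t)))
      (hk.hasDerivAt x t)⟩

theorem contDiff (hg : TimeC1 g g') (x : ℝ) :
    ContDiff ℝ 1 fun t => g (x, t) := by
  rw [contDiff_one_iff_deriv]
  refine ⟨fun t => (hg.hasDerivAt x t).differentiableAt, ?_⟩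
  rw [show deriv (fun t => g (x, t)) = fun t => g' (x, t) from
    funext fun t => (hg.hasDerivAt x t).deriv]
  exact hg.cont'.comp (by fun_prop)

/-- A reparametrization of the space variable. -/
theorem comp_space (hg : TimeC1 g g') {y : ℝ → ℝ} (hy : Continuous y) :
    TimeC1 (fun q => g (y q.1, q.2)) (fun q => g' (y q.1, q.2)) :=
  ⟨hg.cont.comp (by fun_prop), hg.cont'.comp (by fun_prop), fun x t => hg.hasDerivAt (y x) t⟩

end TimeC1

/-- Differentiation of an integral whose integrand and its derivative are continuous. -/
theorem hasDerivAt_integral_of_continuous {f f' : ℝ → ℝ → ℝ} {a b s₀ : ℝ} {U : Set ℝ}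
    (hU : U ∈ 𝓝 s₀) (hf : Continuous f.uncurry) (hf' : Continuous f'.uncurry)
    (hd : ∀ ξ ∈ uIcc a b, ∀ s ∈ U, HasDerivAt (fun s => f ξ s) (f' ξ s) s) :
    HasDerivAt (fun s => ∫ ξ in a..b, f ξ s) (∫ ξ in a..b, f' ξ s₀) s₀ := by
  obtain ⟨C, hC⟩ := (isCompact_uIcc.prod
    (isCompact_Icc (a := s₀ - 1) (b := s₀ + 1))).exists_bound_of_continuousOn
    (f := f'.uncurry) (s := uIcc a b ×ˢ Icc (s₀ - 1) (s₀ + 1)) hf'.continuousOn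
  have hfs : ∀ s, Continuous fun ξ => f ξ s := fun s =>
    hf.comp (by fun_prop : Continuous fun ξ : ℝ => (ξ, s))
  have hfs' : ∀ s, Continuous fun ξ => f' ξ s := fun s =>
    hf'.comp (by fun_prop : Continuous fun ξ : ℝ => (ξ, s))
  refine (intervalIntegral.hasDerivAt_integral_of_dominated_loc_of_deriv_le (F := fun s ξ => f ξ s)
    (F' := fun s ξ => f' ξ s) (bound := fun _ => C) (s := U ∩ Icc (s₀ - 1) (s₀ + 1))
    (inter_mem hU (Icc_mem_nhds (by linarith) (by linarith)))
    (Eventually.of_forall fun s => (hfs s).aestronglyMeasurable) ((hfs s₀).intervalIntegrable _ _)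
    (hfs' s₀).aestronglyMeasurable ?_ intervalIntegrable_const ?_).2
  · exact Eventually.of_forall fun ξ hξ s hs => hC (ξ, s) ⟨uIoc_subset_uIcc hξ, hs.2⟩
  · exact Eventually.of_forall fun ξ hξ s hs => hd ξ (uIoc_subset_uIcc hξ) s hs.1

theorem TimeC1.integral {g g' : ℝ × ℝ → ℝ} (hg : TimeC1 g g') (x₀ : ℝ) :
    TimeC1 (fun q => ∫ ξ in x₀..q.1, g (ξ, q.2)) (fun q => ∫ ξ in x₀..q.1, g' (ξ, q.2)) := by
  refine ⟨?_, ?_, fun x t => ?_⟩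
  · refine intervalIntegral.continuous_parametric_intervalIntegral_of_continuous
      (f := fun (q : ℝ × ℝ) ξ => g (ξ, q.2)) (hg.cont.comp ?_) continuous_fst
    exact continuous_snd.prodMk (continuous_snd.comp continuous_fst)
  · refine intervalIntegral.continuous_parametric_intervalIntegral_of_continuous
      (f := fun (q : ℝ × ℝ) ξ => g' (ξ, q.2)) (hg.cont'.comp ?_) continuous_fst
    exact continuous_snd.prodMk (continuous_snd.comp continuous_fst)
  · exact hasDerivAt_integral_of_continuous (f := fun ξ s => g (ξ, s)) (f' := fun ξ s => g' (ξ, s))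
      univ_mem hg.cont hg.cont' fun ξ _ s _ => hg.hasDerivAt ξ s

/-- The mean of `g` over the segment `{x} × [t, t']`. For `g` a time derivative this is the
difference quotient of its primitive, and it is jointly continuous, also on the diagonal. -/
def timeMean (g : ℝ × ℝ → ℝ) (x t' t : ℝ) : ℝ := ∫ θ in (0 : ℝ)..1, g (x, t + θ * (t' - t))

theorem timeMean_self (g : ℝ × ℝ → ℝ) (x t : ℝ) : timeMean g x t t = g (x, t) := by
  simp [timeMean]

theorem continuous_timeMean {g : ℝ × ℝ → ℝ} (hg : Continuous g) :
    Continuous fun p : ℝ × ℝ × ℝ => timeMean g p.1 p.2.1 p.2.2 := by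
  refine intervalIntegral.continuous_parametric_intervalIntegral_of_continuous'
    (f := fun (p : ℝ × ℝ × ℝ) θ => g (p.1, p.2.2 + θ * (p.2.1 - p.2.2))) (hg.comp ?_) 0 1
  fun_prop

theorem TimeC1.sub_eq {g g' : ℝ × ℝ → ℝ} (hg : TimeC1 g g') (x t' t : ℝ) :
    g (x, t') - g (x, t) = timeMean g' x t' t * (t' - t) := by
  have h : ∀ θ ∈ uIcc (0 : ℝ) 1, HasDerivAt (fun θ : ℝ => g (x, t + θ * (t' - t)))
      (g' (x, t + θ * (t' - t)) * (t' - t)) θ := fun θ _ => by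
    have h1 : HasDerivAt (fun θ : ℝ => t + θ * (t' - t)) (t' - t) θ := by
      simpa using ((hasDerivAt_id θ).mul_const (t' - t)).const_add t
    exact HasDerivAt.comp θ (hg.hasDerivAt x _) h1
  have hi := intervalIntegral.integral_eq_sub_of_hasDerivAt h
    (((hg.cont'.comp (by fun_prop)).mul continuous_const).intervalIntegrable _ _)
  rw [intervalIntegral.integral_mul_const] at hi
  rw [timeMean, hi]
  simp

theorem abs_timeMean_le {g : ℝ × ℝ → ℝ} {K : ℝ} (hK : ∀ q, |g q| ≤ K) (x t' t : ℝ) :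
    |timeMean g x t' t| ≤ K := by
  have := intervalIntegral.norm_integral_le_of_norm_le_const (a := 0) (b := 1)
    (f := fun θ => g (x, t + θ * (t' - t))) fun θ _ => hK _
  simpa [timeMean] using this

/-- A product one of whose factors vanishes at the point is differentiable there as soon as this
factor is, if the other one is continuous. -/
theorem hasFDerivWithinAt_mul_of_eq_zero {E : Type*} [NormedAddCommGroup E] [NormedSpace ℝ E]
    {A f : E → ℝ} {f' : E →L[ℝ] ℝ} {s : Set E} {x : E} (hA : ContinuousWithinAt A s x)
    (hf : HasFDerivWithinAt f f' s x) (h0 : f x = 0) :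
    HasFDerivWithinAt (fun y => A y * f y) (A x • f') s x := by
  have h1 : HasFDerivWithinAt (fun y => A x * f y) (A x • f') s x := hf.const_mul (A x)
  have h2 : (fun y => (A y - A x) * f y) =o[𝓝[s] x] fun y => y - x := by
    have h3 : f =O[𝓝[s] x] fun y => y - x := by
      simpa [h0] using hf.isBigO_sub
    have h4 : (fun y => A y - A x) =o[𝓝[s] x] fun _ => (1 : ℝ) := by
      rw [Asymptotics.isLittleO_one_iff]
      simpa using hA.sub_const (A x)
    simpa using (h4.mul_isBigO h3.norm_right).norm_right
  refine (HasFDerivWithinAt.of_isLittleO ?_)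
  refine (h1.isLittleO.add h2).congr_left fun y => ?_
  simp [h0]; ring

theorem hasDerivWithinAt_mul_of_eq_zero {A f : ℝ → ℝ} {f' : ℝ} {s : Set ℝ} {x : ℝ}
    (hA : ContinuousWithinAt A s x) (hf : HasDerivWithinAt f f' s x) (h0 : f x = 0) :
    HasDerivWithinAt (fun y => A y * f y) (A x * f') s x := by
  have := (hasFDerivWithinAt_mul_of_eq_zero hA hf.hasFDerivWithinAt h0).hasDerivWithinAt
  simpa using this

/-- Variation of constants on `[0,1]`. -/
theorem eq_of_linear_ode {y β g : ℝ → ℝ} (hβ : Continuous β) (hg : Continuous g)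
    (hy : ∀ ξ ∈ Icc (0 : ℝ) 1, HasDerivWithinAt y (β ξ * y ξ + g ξ) (Icc 0 1) ξ)
    {x ξ : ℝ} (hx : x ∈ Icc (0 : ℝ) 1) (hξ : ξ ∈ Icc (0 : ℝ) 1) :
    y ξ = Real.exp (∫ η in x..ξ, β η) *
      (y x + ∫ η in x..ξ, Real.exp (-∫ ζ in x..η, β ζ) * g η) := by
  have hB : ∀ η, HasDerivAt (fun η => ∫ ζ in x..η, β ζ) (β η) η := fun η =>
    intervalIntegral.integral_hasDerivAt_right (hβ.intervalIntegrable _ _)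
      (hβ.stronglyMeasurableAtFilter _ _) hβ.continuousAt
  have hBc : Continuous fun η => ∫ ζ in x..η, β ζ :=
    continuous_iff_continuousAt.2 fun η => (hB η).continuousAt
  have hyc : ContinuousOn y (Icc 0 1) := fun η hη => (hy η hη).continuousWithinAt
  have h := intervalIntegral.integral_eq_sub_of_hasDeriv_right (a := x) (b := ξ)
    (f := fun η => Real.exp (-∫ ζ in x..η, β ζ) * y η)
    (f' := fun η => Real.exp (-∫ ζ in x..η, β ζ) * g η)
    ((hBc.neg.rexp.continuousOn).mul (hyc.mono (uIcc_subset_unit hx hξ)))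
    (fun η hη => by
      have hη' := Ioo_min_max_subset_unit hx hξ hη
      have h1 := (hy η ⟨hη'.1.le, hη'.2.le⟩).hasDerivAt (Icc_mem_nhds hη'.1 hη'.2)
      have h2 := ((hB η).neg.exp.mul h1).hasDerivWithinAt (s := Ioi η)
      refine h2.congr_deriv ?_
      simp only [Pi.neg_apply]
      ring)
    ((hBc.neg.rexp.mul hg).intervalIntegrable _ _)
  rw [h]
  simp only [intervalIntegral.integral_same, neg_zero, Real.exp_zero, one_mul]
  rw [add_sub_cancel, ← mul_assoc, ← Real.exp_add, add_neg_cancel, Real.exp_zero, one_mul]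

/-! ### The characteristic flow -/

/-- `F` and its time derivative `F'` are continuous and bounded on the plane. Here `F` stands for
the slope `dt/dx` of the characteristics, the reciprocal of the speed. -/
structure IsSlope (F F' : ℝ × ℝ → ℝ) : Prop extends TimeC1 F F' where
  bdd : ∃ L, ∀ q, |F q| ≤ L
  bdd' : ∃ K, ∀ q, |F' q| ≤ K

/-- `w` is an integral curve of the slope field `F` on `[0,1]`. -/
def IsIntegral (F : ℝ × ℝ → ℝ) (w : ℝ → ℝ) : Prop :=
  ∀ ξ ∈ Icc (0 : ℝ) 1, HasDerivWithinAt w (F (ξ, w ξ)) (Icc 0 1) ξ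

/-- The value at `ξ` of the integral curve of the slope field `F` through `(x, t)`; both abscissas
are clamped to `[0,1]`. -/
def flow (F : ℝ × ℝ → ℝ) (ξ x t : ℝ) : ℝ := omega (fun q => 1 / F q) (clamp ξ) (clamp x) t

/-- The time derivative of `flow F ξ x` at `t`, where `F'` is the one of `F`. -/
def flowDeriv (F F' : ℝ × ℝ → ℝ) (ξ x t : ℝ) : ℝ :=
  Real.exp (∫ η in (clamp x)..(clamp ξ), F' (η, flow F η x t))

theorem IsIntegral.continuousOn {F : ℝ × ℝ → ℝ} {w : ℝ → ℝ} (h : IsIntegral F w) :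
    ContinuousOn w (Icc 0 1) := fun ξ hξ => (h ξ hξ).continuousWithinAt

theorem continuous_comp_clamp {w : ℝ → ℝ} (h : ContinuousOn w (Icc 0 1)) :
    Continuous fun ξ => w (clamp ξ) :=
  h.comp_continuous continuous_clamp clamp_mem

theorem flow_clamp_left (F : ℝ × ℝ → ℝ) (ξ x t : ℝ) : flow F (clamp ξ) x t = flow F ξ x t := by
  simp [flow]

theorem flow_clamp_right (F : ℝ × ℝ → ℝ) (ξ x t : ℝ) : flow F ξ (clamp x) t = flow F ξ x t := by
  simp [flow]

namespace IsSlope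

variable {F F' : ℝ × ℝ → ℝ} (hF : IsSlope F F')
include hF

/-- The difference of two integral curves solves a linear equation. -/
theorem integral_sub {w₁ w₂ : ℝ → ℝ} (h₁ : IsIntegral F w₁) (h₂ : IsIntegral F w₂) {x ξ : ℝ}
    (hx : x ∈ Icc (0 : ℝ) 1) (hξ : ξ ∈ Icc (0 : ℝ) 1) :
    w₁ ξ - w₂ ξ = (w₁ x - w₂ x) *
      Real.exp (∫ η in x..ξ, timeMean F' η (w₁ (clamp η)) (w₂ (clamp η))) := by
  have hc : Continuous fun η => timeMean F' η (w₁ (clamp η)) (w₂ (clamp η)) :=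
    (continuous_timeMean hF.cont').comp (continuous_id.prodMk
      ((continuous_comp_clamp h₁.continuousOn).prodMk (continuous_comp_clamp h₂.continuousOn)))
  have := eq_of_linear_ode (y := fun ξ => w₁ ξ - w₂ ξ) (g := fun _ => 0) hc continuous_const
    (fun ξ hξ => by
      refine ((h₁ ξ hξ).sub (h₂ ξ hξ)).congr_deriv ?_
      rw [hF.sub_eq, clamp_of_mem hξ, add_zero]) hx hξ
  simp only [mul_zero, intervalIntegral.integral_zero, add_zero] at this
  rw [this, mul_comm]

theorem integral_eq {w₁ w₂ : ℝ → ℝ} (h₁ : IsIntegral F w₁) (h₂ : IsIntegral F w₂) {x ξ : ℝ}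
    (hx : x ∈ Icc (0 : ℝ) 1) (hξ : ξ ∈ Icc (0 : ℝ) 1) (h : w₁ x = w₂ x) : w₁ ξ = w₂ ξ := by
  have := hF.integral_sub h₁ h₂ hx hξ
  rw [h, sub_self, zero_mul] at this
  linarith

theorem exists_integral {x : ℝ} (hx : x ∈ Icc (0 : ℝ) 1) (t : ℝ) :
    ∃ w, w x = t ∧ IsIntegral F w := by
  obtain ⟨L, hL⟩ := hF.bdd
  obtain ⟨K, hK⟩ := hF.bdd'
  have hpl : IsPicardLindelof (fun ξ s => F (ξ, s)) (tmin := 0) (tmax := 1) ⟨x, hx⟩ t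
      L.toNNReal 0 L.toNNReal K.toNNReal := by
    refine ⟨fun ξ _ => ?_, fun s _ => ?_, fun ξ _ s _ => ?_, ?_⟩
    · refine LipschitzOnWith.of_dist_le_mul fun s _ s' _ => ?_
      rw [Real.dist_eq, Real.dist_eq, hF.sub_eq, abs_mul]
      gcongr
      exact (abs_timeMean_le hK _ _ _).trans (Real.le_coe_toNNReal K)
    · exact (hF.cont.comp (by fun_prop)).continuousOn
    · exact (hL _).trans (Real.le_coe_toNNReal L)
    · simp only [NNReal.coe_zero, sub_zero]
      refine mul_le_of_le_one_right (NNReal.coe_nonneg _) (max_le ?_ ?_)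
      · simpa using hx.1
      · simpa using hx.2
  exact hpl.exists_eq_forall_mem_Icc_hasDerivWithinAt₀

theorem flow_spec (x t : ℝ) :
    flow F x x t = t ∧ IsIntegral F fun ξ => flow F ξ x t := by
  have he : ∃ w, IsCharacteristic (fun q => 1 / F q) (clamp x) t w := by
    obtain ⟨w, hw, h⟩ := hF.exists_integral (clamp_mem x) t
    exact ⟨w, hw, fun ξ hξ => by simpa only [one_div_one_div] using h ξ hξ⟩
  have hs := he.choose_spec
  have hE : ∀ ξ, flow F ξ x t = he.choose (clamp ξ) := fun ξ => by rw [flow, omega, dif_pos he]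
  refine ⟨by rw [hE]; exact hs.1, fun ξ hξ => ?_⟩
  have h1 := hs.2 ξ hξ
  simp only [one_div_one_div] at h1
  simp only [hE, clamp_of_mem hξ]
  exact h1.congr (fun y hy => by rw [clamp_of_mem hy]) (by rw [clamp_of_mem hξ])

theorem flow_self (x t : ℝ) : flow F x x t = t := (hF.flow_spec x t).1

theorem isIntegral_flow (x t : ℝ) : IsIntegral F fun ξ => flow F ξ x t := (hF.flow_spec x t).2

theorem flow_eq {w : ℝ → ℝ} (hw : IsIntegral F w) {x ξ : ℝ} (hx : x ∈ Icc (0 : ℝ) 1)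
    (hξ : ξ ∈ Icc (0 : ℝ) 1) : flow F ξ x (w x) = w ξ :=
  hF.integral_eq (hF.isIntegral_flow _ _) hw hx hξ (hF.flow_self _ _)

theorem flow_flow (ξ y x t : ℝ) : flow F ξ y (flow F y x t) = flow F ξ x t := by
  have := hF.flow_eq (hF.isIntegral_flow x t) (clamp_mem y) (clamp_mem ξ)
  simpa only [flow_clamp_left, flow_clamp_right] using this

theorem flow_sub (ξ x t' t : ℝ) : flow F ξ x t' - flow F ξ x t = (t' - t) *
    Real.exp (∫ η in (clamp x)..(clamp ξ), timeMean F' η (flow F η x t') (flow F η x t)) := by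
  have := hF.integral_sub (hF.isIntegral_flow x t') (hF.isIntegral_flow x t) (clamp_mem x)
    (clamp_mem ξ)
  simpa only [flow_clamp_left, hF.flow_self] using this

theorem exists_lipschitz_flow : ∃ C : ℝ, 0 ≤ C ∧ ∀ ξ x t' t,
    |flow F ξ x t' - flow F ξ x t| ≤ C * |t' - t| := by
  obtain ⟨K, hK⟩ := hF.bdd'
  refine ⟨Real.exp K, (Real.exp_pos _).le, fun ξ x t' t => ?_⟩
  rw [hF.flow_sub, abs_mul, Real.abs_exp, mul_comm]
  gcongr
  have hK0 : 0 ≤ K := (abs_nonneg _).trans (hK 0)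
  refine (le_abs_self _).trans ?_
  refine (intervalIntegral.norm_integral_le_of_norm_le_const (C := K)
    fun η _ => (Real.norm_eq_abs _).trans_le (abs_timeMean_le hK _ _ _)).trans ?_
  refine mul_le_of_le_one_right hK0 (abs_le.2 ⟨?_, ?_⟩) <;>
    linarith [(clamp_mem x).1, (clamp_mem x).2, (clamp_mem ξ).1, (clamp_mem ξ).2]

theorem continuous_flow_left (x t : ℝ) : Continuous fun ξ => flow F ξ x t := by
  simpa only [flow_clamp_left] using continuous_comp_clamp (hF.isIntegral_flow x t).continuousOn

theorem continuous_flow : Continuous fun p : ℝ × ℝ × ℝ => flow F p.1 p.2.1 p.2.2 := by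
  obtain ⟨C, hC0, hC⟩ := hF.exists_lipschitz_flow
  rw [continuous_iff_continuousAt]
  rintro ⟨ξ₀, x₀, t₀⟩
  have h1 : Tendsto (fun p : ℝ × ℝ × ℝ => flow F p.1 x₀ t₀) (𝓝 (ξ₀, x₀, t₀))
      (𝓝 (flow F ξ₀ x₀ t₀)) :=
    ((hF.continuous_flow_left x₀ t₀).comp continuous_fst).tendsto (ξ₀, x₀, t₀)
  have h2 : Tendsto (fun p : ℝ × ℝ × ℝ => C * |p.2.2 - flow F p.2.1 x₀ t₀|) (𝓝 (ξ₀, x₀, t₀))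
      (𝓝 0) := by
    have : Continuous fun p : ℝ × ℝ × ℝ => C * |p.2.2 - flow F p.2.1 x₀ t₀| :=
      continuous_const.mul ((continuous_snd.snd).sub
        ((hF.continuous_flow_left x₀ t₀).comp continuous_snd.fst)).abs
    simpa [hF.flow_self] using this.tendsto (ξ₀, x₀, t₀)
  have h3 : Tendsto (fun p : ℝ × ℝ × ℝ => flow F p.1 p.2.1 p.2.2 - flow F p.1 x₀ t₀)
      (𝓝 (ξ₀, x₀, t₀)) (𝓝 0) := by
    refine squeeze_zero_norm (fun p => ?_) h2
    rw [← hF.flow_flow p.1 p.2.1 x₀ t₀]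
    exact hC _ _ _ _
  have := h3.add h1
  simpa [ContinuousAt] using this

/-- The logarithm of the Jacobian between two integral curves depends continuously on both. -/
theorem continuous_integral_timeMean_flow : Continuous fun p : ℝ × ℝ × ℝ × ℝ =>
    ∫ η in (clamp p.2.1)..(clamp p.1),
      timeMean F' η (flow F η p.2.1 p.2.2.1) (flow F η p.2.1 p.2.2.2) := by
  have hcomp : Continuous fun p : (ℝ × ℝ × ℝ × ℝ) × ℝ =>
      timeMean F' p.2 (flow F p.2 p.1.2.1 p.1.2.2.1) (flow F p.2 p.1.2.1 p.1.2.2.2) := by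
    refine (continuous_timeMean hF.cont').comp (continuous_snd.prodMk (Continuous.prodMk ?_ ?_))
    · exact hF.continuous_flow.comp
        (by fun_prop : Continuous fun p : (ℝ × ℝ × ℝ × ℝ) × ℝ => (p.2, p.1.2.1, p.1.2.2.1))
    · exact hF.continuous_flow.comp
        (by fun_prop : Continuous fun p : (ℝ × ℝ × ℝ × ℝ) × ℝ => (p.2, p.1.2.1, p.1.2.2.2))
  have h : ∀ y : ℝ × ℝ × ℝ × ℝ → ℝ, Continuous y → Continuous fun p : ℝ × ℝ × ℝ × ℝ =>
      ∫ η in (0 : ℝ)..y p,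
        timeMean F' η (flow F η p.2.1 p.2.2.1) (flow F η p.2.1 p.2.2.2) := fun y hy =>
    intervalIntegral.continuous_parametric_intervalIntegral_of_continuous (f := fun
      (p : ℝ × ℝ × ℝ × ℝ) η => timeMean F' η (flow F η p.2.1 p.2.2.1) (flow F η p.2.1 p.2.2.2))
      hcomp hy
  have hi : ∀ (p : ℝ × ℝ × ℝ × ℝ) a b, IntervalIntegrable (fun η =>
      timeMean F' η (flow F η p.2.1 p.2.2.1) (flow F η p.2.1 p.2.2.2)) volume a b := fun p a b =>
    (hcomp.comp (by fun_prop : Continuous fun η : ℝ => (p, η))).intervalIntegrable _ _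
  refine ((h (fun p => clamp p.1) (by fun_prop)).sub
    (h (fun p => clamp p.2.1) (by fun_prop))).congr fun p => ?_
  exact (intervalIntegral.integral_interval_sub_left (hi p _ _) (hi p _ _))

omit hF in
theorem flowDeriv_eq (ξ x t : ℝ) : flowDeriv F F' ξ x t =
    Real.exp (∫ η in (clamp x)..(clamp ξ), timeMean F' η (flow F η x t) (flow F η x t)) := by
  simp only [timeMean_self, flowDeriv]

theorem continuous_flowDeriv :
    Continuous fun p : ℝ × ℝ × ℝ => flowDeriv F F' p.1 p.2.1 p.2.2 := by
  simp only [flowDeriv_eq]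
  exact (hF.continuous_integral_timeMean_flow.comp
    (by fun_prop : Continuous fun p : ℝ × ℝ × ℝ => (p.1, p.2.1, p.2.2, p.2.2))).rexp

/-- The flow along a curve `y ↦ (y, τ y)` of base points. -/
theorem hasDerivWithinAt_flow_comp {τ : ℝ → ℝ} {τ' x : ℝ} (ξ : ℝ) (hx : x ∈ Icc (0 : ℝ) 1)
    (hτ : HasDerivWithinAt τ τ' (Icc 0 1) x) :
    HasDerivWithinAt (fun y => flow F ξ y (τ y))
      (flowDeriv F F' ξ x (τ x) * (τ' - F (x, τ x))) (Icc 0 1) x := by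
  have hw := hF.isIntegral_flow x (τ x)
  have h1 := hτ.sub (hw x hx)
  simp only [hF.flow_self] at h1
  have hA : ContinuousWithinAt (fun y => Real.exp (∫ η in (clamp y)..(clamp ξ),
      timeMean F' η (flow F η y (τ y)) (flow F η y (flow F y x (τ x))))) (Icc 0 1) x :=
    Real.continuous_exp.continuousAt.comp_continuousWithinAt
      (hF.continuous_integral_timeMean_flow.continuousAt.comp_continuousWithinAt
        (f := fun y => (ξ, y, τ y, flow F y x (τ x)))
        (continuousWithinAt_const.prodMk (continuousWithinAt_id.prodMk
          (hτ.continuousWithinAt.prodMk (hF.continuous_flow_left x (τ x)).continuousWithinAt))))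
  have h2 := hasDerivWithinAt_mul_of_eq_zero hA h1 (by simp [hF.flow_self])
  have h3 := h2.add_const (flow F ξ x (τ x))
  rw [hF.flow_self, ← flowDeriv_eq] at h3
  refine h3.congr_of_mem (fun y _ => ?_) hx
  have := hF.flow_sub ξ y (τ y) (flow F y x (τ x))
  rw [hF.flow_flow] at this
  simp only [Pi.sub_apply]
  linarith

theorem hasDerivAt_flow (ξ x t : ℝ) :
    HasDerivAt (fun s => flow F ξ x s) (flowDeriv F F' ξ x t) t := by
  have hA : ContinuousAt (fun s => Real.exp (∫ η in (clamp x)..(clamp ξ),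
      timeMean F' η (flow F η x s) (flow F η x t))) t :=
    ((hF.continuous_integral_timeMean_flow.comp
      (by fun_prop : Continuous fun s : ℝ => (ξ, x, s, t))).rexp).continuousAt
  have h := hasDerivWithinAt_mul_of_eq_zero (s := univ) (f := fun s => s - t)
    hA.continuousWithinAt ((hasDerivWithinAt_id t univ).sub_const t) (by simp)
  have h' := (hasDerivWithinAt_univ.1 h).add_const (flow F ξ x t)
  rw [← flowDeriv_eq, mul_one] at h'
  refine h'.congr_of_eventuallyEq (Eventually.of_forall fun s => ?_)
  have := hF.flow_sub ξ x s t
  simp only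
  linarith

theorem timeC1_flow (x : ℝ) :
    TimeC1 (fun q => flow F q.1 x q.2) (fun q => flowDeriv F F' q.1 x q.2) :=
  ⟨hF.continuous_flow.comp (by fun_prop : Continuous fun q : ℝ × ℝ => (q.1, x, q.2)),
    hF.continuous_flowDeriv.comp (by fun_prop : Continuous fun q : ℝ × ℝ => (q.1, x, q.2)),
    fun ξ t => hF.hasDerivAt_flow ξ x t⟩

theorem timeC1_flow_foot (ξ : ℝ) :
    TimeC1 (fun q => flow F ξ q.1 q.2) (fun q => flowDeriv F F' ξ q.1 q.2) :=
  ⟨hF.continuous_flow.comp (by fun_prop : Continuous fun q : ℝ × ℝ => (ξ, q.1, q.2)),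
    hF.continuous_flowDeriv.comp (by fun_prop : Continuous fun q : ℝ × ℝ => (ξ, q.1, q.2)),
    fun x t => hF.hasDerivAt_flow ξ x t⟩

theorem flowDeriv_mul_flowDeriv (x y t : ℝ) :
    flowDeriv F F' x y (flow F y x t) * flowDeriv F F' y x t = 1 := by
  simp only [flowDeriv, hF.flow_flow, ← Real.exp_add]
  rw [intervalIntegral.integral_symm, neg_add_cancel, Real.exp_zero]

theorem hasDerivWithinAt_flowDeriv (x t : ℝ) {ξ : ℝ} (hξ : ξ ∈ Icc (0 : ℝ) 1) :
    HasDerivWithinAt (fun ξ => flowDeriv F F' ξ x t)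
      (flowDeriv F F' ξ x t * F' (ξ, flow F ξ x t)) (Icc 0 1) ξ := by
  have hc : Continuous fun η => F' (η, flow F η x t) :=
    hF.cont'.comp (continuous_id.prodMk (hF.continuous_flow_left x t))
  have h : HasDerivAt (fun ξ => Real.exp (∫ η in (clamp x)..ξ, F' (η, flow F η x t)))
      (Real.exp (∫ η in (clamp x)..ξ, F' (η, flow F η x t)) * F' (ξ, flow F ξ x t)) ξ :=
    (intervalIntegral.integral_hasDerivAt_right (hc.intervalIntegrable _ _)
      (hc.stronglyMeasurableAtFilter _ _) hc.continuousAt).exp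
  have h' := h.hasDerivWithinAt (s := Icc 0 1)
  have e : ∀ y ∈ Icc (0 : ℝ) 1, flowDeriv F F' y x t =
      Real.exp (∫ η in (clamp x)..y, F' (η, flow F η x t)) := fun y hy => by
    rw [flowDeriv, clamp_of_mem hy]
  rw [e ξ hξ]
  exact h'.congr_of_mem e hξ

theorem flow_add_period {T : ℝ} (hT : ∀ x t, F (x, t + T) = F (x, t)) (ξ x t : ℝ) :
    flow F ξ x (t + T) = flow F ξ x t + T := by
  have hw : IsIntegral F fun ξ => flow F ξ x t + T := fun ξ hξ => by
    rw [hT]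
    exact (hF.isIntegral_flow x t ξ hξ).add_const T
  have := hF.flow_eq hw (clamp_mem x) (clamp_mem ξ)
  simpa only [flow_clamp_left, flow_clamp_right, hF.flow_self] using this

end IsSlope

/-! ### Integrals along a transversal family of curves -/

/-- The chain rule for a function of two variables with continuous partial derivatives. -/
theorem hasDerivAt_comp_of_partial {A A₁ A₂ : ℝ × ℝ → ℝ} {U : Set ℝ} {ξ τ' : ℝ} {τ : ℝ → ℝ}
    (hU : U ∈ 𝓝 ξ) (h₁ : ∀ x ∈ U, ∀ s, HasDerivAt (fun x => A (x, s)) (A₁ (x, s)) x)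
    (h₂ : ∀ x s, HasDerivAt (fun s => A (x, s)) (A₂ (x, s)) s)
    (c₁ : Continuous A₁) (c₂ : Continuous A₂) (hτ : HasDerivAt τ τ' ξ) :
    HasDerivAt (fun x => A (x, τ x)) (A₁ (ξ, τ ξ) + A₂ (ξ, τ ξ) * τ') ξ := by
  have h := hasStrictFDerivAt_uncurry_coprod (𝕜 := ℝ) (u := (ξ, τ ξ)) (f := fun x s => A (x, s))
    (f₁ := fun x s => ContinuousLinearMap.toSpanSingleton ℝ (A₁ (x, s)))
    (f₂ := fun x s => ContinuousLinearMap.toSpanSingleton ℝ (A₂ (x, s)))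
    (by
      have : U ×ˢ univ ∈ 𝓝 (ξ, τ ξ) := prod_mem_nhds hU univ_mem
      filter_upwards [this] with v hv using (h₁ v.1 hv.1 v.2).hasFDerivAt)
    (Eventually.of_forall fun v => (h₂ v.1 v.2).hasFDerivAt)
    ((ContinuousLinearMap.toSpanSingletonCLE (𝕜 := ℝ) (E := ℝ)).continuous.comp c₁).continuousAt
    ((ContinuousLinearMap.toSpanSingletonCLE (𝕜 := ℝ) (E := ℝ)).continuous.comp c₂).continuousAt
  have h' := h.hasFDerivAt.comp_hasDerivAt ξ ((hasDerivAt_id ξ).prodMk hτ)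
  refine h'.congr_deriv ?_
  simp [Function.HasUncurry.uncurry, mul_comm]

/-- `A (ξ, σ) = ∫ V (ξ, τ) dτ` over `[0, σ]`. -/
def timePrimitive (V : ℝ × ℝ → ℝ) (q : ℝ × ℝ) : ℝ := ∫ τ in (0 : ℝ)..q.2, V (q.1, τ)

theorem timeC1_timePrimitive {V : ℝ × ℝ → ℝ} (hV : Continuous V) : TimeC1 (timePrimitive V) V := by
  refine ⟨?_, hV, fun x t => ?_⟩
  · exact intervalIntegral.continuous_parametric_intervalIntegral_of_continuous
      (f := fun (q : ℝ × ℝ) τ => V (q.1, τ)) (hV.comp (by fun_prop)) continuous_snd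
  · have hc : Continuous fun τ => V (x, τ) := hV.comp (by fun_prop)
    exact intervalIntegral.integral_hasDerivAt_right (hc.intervalIntegrable _ _)
      (hc.stronglyMeasurableAtFilter _ _) hc.continuousAt

/-- The time derivative of `∫ N ∂_ξθ V(ξ, θ)`, in which neither `V` nor `∂_ξθ` has to be
differentiable in time: what is differentiable is the primitive of `V` in its second variable, whose
derivative along the curves `ξ ↦ (ξ, θ (ξ, s))` contains `∂_ξθ V(ξ, θ)`. -/
def transversalDeriv (N Ns Nx V Q θ θs θx : ℝ × ℝ → ℝ) (x₀ x s : ℝ) : ℝ :=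
  (∫ ξ in x₀..x, Ns (ξ, s) * (θx (ξ, s) * V (ξ, θ (ξ, s)))) +
    (N (x, s) * (V (x, θ (x, s)) * θs (x, s)) - N (x₀, s) * (V (x₀, θ (x₀, s)) * θs (x₀, s)) -
      ∫ ξ in x₀..x, (Nx (ξ, s) * (V (ξ, θ (ξ, s)) * θs (ξ, s)) +
        N (ξ, s) * (Q (ξ, θ (ξ, s)) * θs (ξ, s))))

section

variable {N Ns Nx V Q θ θs θx : ℝ × ℝ → ℝ}

theorem hasDerivAt_integral_transversal
    (hN : TimeC1 N Ns) (hNx : Continuous Nx)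
    (hNd : ∀ ξ ∈ Ioo (0 : ℝ) 1, ∀ s, HasDerivAt (fun ξ => N (ξ, s)) (Nx (ξ, s)) ξ)
    (hV : Continuous V) (hQ : Continuous Q)
    (hVd : ∀ ξ ∈ Ioo (0 : ℝ) 1, ∀ s, HasDerivAt (fun ξ => V (ξ, s)) (Q (ξ, s)) ξ)
    (hθ : TimeC1 θ θs) (hθx : Continuous θx)
    (hθd : ∀ ξ ∈ Ioo (0 : ℝ) 1, ∀ s, HasDerivAt (fun ξ => θ (ξ, s)) (θx (ξ, s)) ξ)
    {x₀ x : ℝ} (hx₀ : x₀ ∈ Icc (0 : ℝ) 1) (hx : x ∈ Icc (0 : ℝ) 1) (s₀ : ℝ) :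
    HasDerivAt (fun s => ∫ ξ in x₀..x, N (ξ, s) * (θx (ξ, s) * V (ξ, θ (ξ, s))))
      (transversalDeriv N Ns Nx V Q θ θs θx x₀ x s₀) s₀ := by
  set A := timePrimitive V
  set R := timePrimitive Q
  have hA : TimeC1 A V := timeC1_timePrimitive hV
  have hR : TimeC1 R Q := timeC1_timePrimitive hQ
  have hAθ := hA.comp hθ
  have hRθ := hR.comp hθ
  have hAx : ∀ ξ ∈ Ioo (0 : ℝ) 1, ∀ s, HasDerivAt (fun ξ => A (ξ, s)) (R (ξ, s)) ξ :=
    fun ξ hξ s => hasDerivAt_integral_of_continuous (f := fun τ ξ => V (ξ, τ))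
      (f' := fun τ ξ => Q (ξ, τ)) (Ioo_mem_nhds hξ.1 hξ.2) (hV.comp continuous_swap)
      (hQ.comp continuous_swap) fun τ _ y hy => hVd y hy τ
  have hAc : ∀ ξ ∈ Ioo (0 : ℝ) 1, ∀ s, HasDerivAt (fun ξ => A (ξ, θ (ξ, s)))
      (R (ξ, θ (ξ, s)) + V (ξ, θ (ξ, s)) * θx (ξ, s)) ξ := fun ξ hξ s =>
    hasDerivAt_comp_of_partial (Ioo_mem_nhds hξ.1 hξ.2) hAx hA.hasDerivAt hR.cont hV (hθd ξ hξ s)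
  have line : ∀ {g : ℝ × ℝ → ℝ}, Continuous g → ∀ s, Continuous fun ξ => g (ξ, s) :=
    fun hg s => hg.comp (by fun_prop)
  have hVθ : Continuous fun q : ℝ × ℝ => V (q.1, θ q) :=
    hV.comp (continuous_fst.prodMk hθ.cont)
  -- integration by parts, with `N` frozen at the time `s₀`
  have ibp : ∀ s, ∫ ξ in x₀..x, N (ξ, s₀) * (θx (ξ, s) * V (ξ, θ (ξ, s))) =
      N (x, s₀) * A (x, θ (x, s)) - N (x₀, s₀) * A (x₀, θ (x₀, s)) -
        ∫ ξ in x₀..x, (Nx (ξ, s₀) * A (ξ, θ (ξ, s)) + N (ξ, s₀) * R (ξ, θ (ξ, s))) := fun s => by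
    have h := intervalIntegral.integral_deriv_mul_eq_sub_of_hasDerivAt (a := x₀) (b := x)
      (u := fun ξ => N (ξ, s₀)) (v := fun ξ => A (ξ, θ (ξ, s)))
      (line hN.cont s₀).continuousOn (line hAθ.cont s).continuousOn
      (fun ξ hξ => hNd ξ (Ioo_min_max_subset_unit hx₀ hx hξ) s₀)
      (fun ξ hξ => hAc ξ (Ioo_min_max_subset_unit hx₀ hx hξ) s)
      ((line hNx s₀).intervalIntegrable _ _)
      (((line hRθ.cont s).add ((line hVθ s).mul (line hθx s))).intervalIntegrable _ _)
    rw [← h, ← intervalIntegral.integral_sub]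
    · refine intervalIntegral.integral_congr fun ξ _ => ?_
      ring
    · exact (((line hNx s₀).mul (line hAθ.cont s)).add ((line hN.cont s₀).mul
        ((line hRθ.cont s).add ((line hVθ s).mul (line hθx s))))).intervalIntegrable _ _
    · exact (((line hNx s₀).mul (line hAθ.cont s)).add
        ((line hN.cont s₀).mul (line hRθ.cont s))).intervalIntegrable _ _
  have frozen : HasDerivAt (fun s => ∫ ξ in x₀..x, N (ξ, s₀) * (θx (ξ, s) * V (ξ, θ (ξ, s))))
      (N (x, s₀) * (V (x, θ (x, s₀)) * θs (x, s₀)) -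
        N (x₀, s₀) * (V (x₀, θ (x₀, s₀)) * θs (x₀, s₀)) -
        ∫ ξ in x₀..x, (Nx (ξ, s₀) * (V (ξ, θ (ξ, s₀)) * θs (ξ, s₀)) +
        N (ξ, s₀) * (Q (ξ, θ (ξ, s₀)) * θs (ξ, s₀)))) s₀ := by
    simp only [ibp]
    refine (((hAθ.hasDerivAt x s₀).const_mul _).sub ((hAθ.hasDerivAt x₀ s₀).const_mul _)).sub ?_
    have hN₀ : Continuous fun q : ℝ × ℝ => N (q.1, s₀) := hN.cont.comp (by fun_prop)
    have hNx₀ : Continuous fun q : ℝ × ℝ => Nx (q.1, s₀) := hNx.comp (by fun_prop)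
    exact hasDerivAt_integral_of_continuous
      (f := fun ξ s => Nx (ξ, s₀) * A (ξ, θ (ξ, s)) + N (ξ, s₀) * R (ξ, θ (ξ, s)))
      (f' := fun ξ s => Nx (ξ, s₀) * (V (ξ, θ (ξ, s)) * θs (ξ, s)) +
        N (ξ, s₀) * (Q (ξ, θ (ξ, s)) * θs (ξ, s))) univ_mem
      ((hNx₀.mul hAθ.cont).add (hN₀.mul hRθ.cont)) ((hNx₀.mul hAθ.cont').add (hN₀.mul hRθ.cont'))
      fun ξ _ s _ => ((hAθ.hasDerivAt ξ s).const_mul _).add ((hRθ.hasDerivAt ξ s).const_mul _)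
  -- the contribution of the variation of `N`
  have hm : Continuous fun p : ℝ × ℝ => timeMean Ns p.2 p.1 s₀ :=
    (continuous_timeMean hN.cont').comp
      (by fun_prop : Continuous fun p : ℝ × ℝ => (p.2, p.1, s₀))
  have hB : Continuous fun s => ∫ ξ in x₀..x,
      timeMean Ns ξ s s₀ * (θx (ξ, s) * V (ξ, θ (ξ, s))) :=
    intervalIntegral.continuous_parametric_intervalIntegral_of_continuous'
      (f := fun s ξ => timeMean Ns ξ s s₀ * (θx (ξ, s) * V (ξ, θ (ξ, s))))
      (hm.mul ((hθx.mul hVθ).comp continuous_swap)) _ _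
  have vary := (hasDerivWithinAt_univ.1 (hasDerivWithinAt_mul_of_eq_zero (s := univ)
    (f := fun s => s - s₀) hB.continuousWithinAt
    ((hasDerivWithinAt_id s₀ univ).sub_const s₀) (by simp))).add frozen
  simp only [timeMean_self, mul_one] at vary
  refine vary.congr_of_eventuallyEq (Eventually.of_forall fun s => ?_)
  simp only [Pi.add_apply]
  rw [← intervalIntegral.integral_mul_const, ← intervalIntegral.integral_add]
  · refine intervalIntegral.integral_congr fun ξ _ => ?_
    have := hN.sub_eq ξ s s₀
    linear_combination (θx (ξ, s) * V (ξ, θ (ξ, s))) * this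
  · exact (((hm.comp (by fun_prop : Continuous fun ξ : ℝ => (s, ξ))).mul
      ((line hθx s).mul (line hVθ s))).mul continuous_const).intervalIntegrable _ _
  · exact ((line hN.cont s₀).mul ((line hθx s).mul (line hVθ s))).intervalIntegrable _ _

theorem timeC1_integral_transversal
    (hN : TimeC1 N Ns) (hNx : Continuous Nx)
    (hNd : ∀ ξ ∈ Ioo (0 : ℝ) 1, ∀ s, HasDerivAt (fun ξ => N (ξ, s)) (Nx (ξ, s)) ξ)
    (hV : Continuous V) (hQ : Continuous Q)
    (hVd : ∀ ξ ∈ Ioo (0 : ℝ) 1, ∀ s, HasDerivAt (fun ξ => V (ξ, s)) (Q (ξ, s)) ξ)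
    (hθ : TimeC1 θ θs) (hθx : Continuous θx)
    (hθd : ∀ ξ ∈ Ioo (0 : ℝ) 1, ∀ s, HasDerivAt (fun ξ => θ (ξ, s)) (θx (ξ, s)) ξ)
    {x₀ : ℝ} (hx₀ : x₀ ∈ Icc (0 : ℝ) 1) :
    TimeC1 (fun q => ∫ ξ in x₀..clamp q.1, N (ξ, q.2) * (θx (ξ, q.2) * V (ξ, θ (ξ, q.2))))
      (fun q => transversalDeriv N Ns Nx V Q θ θs θx x₀ (clamp q.1) q.2) := by
  have int : ∀ {g : ℝ × ℝ → ℝ}, Continuous g →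
      Continuous fun q : ℝ × ℝ => ∫ ξ in x₀..clamp q.1, g (ξ, q.2) := fun {g} hg =>
    intervalIntegral.continuous_parametric_intervalIntegral_of_continuous
      (f := fun (q : ℝ × ℝ) ξ => g (ξ, q.2)) (hg.comp (by fun_prop)) (by fun_prop)
  have hVθ : Continuous fun q : ℝ × ℝ => V (q.1, θ q) :=
    hV.comp (continuous_fst.prodMk hθ.cont)
  have hQθ : Continuous fun q : ℝ × ℝ => Q (q.1, θ q) :=
    hQ.comp (continuous_fst.prodMk hθ.cont)
  have hb : Continuous fun q => N q * (V (q.1, θ q) * θs q) := hN.cont.mul (hVθ.mul hθ.cont')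
  refine ⟨int (hN.cont.mul (hθx.mul hVθ)), ?_, fun x t =>
    hasDerivAt_integral_transversal hN hNx hNd hV hQ hVd hθ hθx hθd hx₀ (clamp_mem x) t⟩
  refine (int (hN.cont'.mul (hθx.mul hVθ))).add (((hb.comp ?_).sub (hb.comp ?_)).sub
    (int ((hNx.mul (hVθ.mul hθ.cont')).add (hN.cont.mul (hQθ.mul hθ.cont')))))
  · exact (by fun_prop : Continuous fun q : ℝ × ℝ => (clamp q.1, q.2))
  · exact (by fun_prop : Continuous fun q : ℝ × ℝ => (x₀, q.2))

end

/-! ### Periodic solutions of a contractive functional equation -/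

/-- Every time slice of a function that is `T`-periodic in time is a slice at a time in `[0, T]`. -/
theorem exists_mem_period {Y Z : Type*} {T : ℝ} (hT : 0 < T) {g : ℝ → Y → Z}
    (hg : ∀ t y, g (t + T) y = g t y) (t : ℝ) : ∃ t' ∈ Icc 0 T, ∀ y, g t y = g t' y := by
  have hp : Function.Periodic g T := fun t => funext fun y => hg t y
  obtain ⟨t', ht', h⟩ := hp.exists_mem_Ico₀ hT t
  exact ⟨t', ⟨ht'.1, ht'.2.le⟩, fun y => congrFun h y⟩

theorem exists_bound_of_periodic {E : Type*} [NormedAddCommGroup E] {T : ℝ} (hT : 0 < T)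
    {g : ℝ → E} (hg : ∀ t, g (t + T) = g t) (hc : Continuous g) : ∃ C, 0 ≤ C ∧ ∀ t, ‖g t‖ ≤ C := by
  obtain ⟨C, hC⟩ := (isCompact_Icc (a := 0) (b := T)).exists_bound_of_continuousOn hc.continuousOn
  refine ⟨C, (norm_nonneg _).trans (hC 0 ⟨le_rfl, hT.le⟩), fun t => ?_⟩
  obtain ⟨t', ht', h⟩ := exists_mem_period (g := fun t (_ : Unit) => g t) hT (fun t _ => hg t) t
  rw [h ()]
  exact hC t' ht'

theorem exists_lt_one_of_periodic {Y : Type*} [TopologicalSpace Y] {T : ℝ} (hT : 0 < T)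
    {g : ℝ × Y → ℝ} (hg : ∀ t y, g (t + T, y) = g (t, y)) (hc : Continuous g) {K : Set Y}
    (hK : IsCompact K) (h1 : ∀ q, g q < 1) :
    ∃ θ, 0 ≤ θ ∧ θ < 1 ∧ ∀ t, ∀ y ∈ K, g (t, y) ≤ θ := by
  rcases K.eq_empty_or_nonempty with rfl | hne
  · exact ⟨0, le_rfl, one_pos, by simp⟩
  obtain ⟨q, -, hq⟩ := ((isCompact_Icc (a := 0) (b := T)).prod hK).exists_isMaxOn
    ((nonempty_Icc.2 hT.le).prod hne) hc.continuousOn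
  refine ⟨max 0 (g q), le_max_left _ _, max_lt one_pos (h1 q), fun t y hy => ?_⟩
  obtain ⟨t', ht', h⟩ := exists_mem_period (g := fun t y => g (t, y)) hT hg t
  rw [h y]
  exact (hq ⟨ht', hy⟩).trans (le_max_right _ _)

/-- Uniform convergence is preserved by a continuous function that is periodic in `t`. -/
theorem tendstoUniformly_comp_of_periodic {E Z : Type*} [NormedAddCommGroup E] [NormedAddCommGroup Z]
    [ProperSpace E] {T : ℝ} (hT : 0 < T) {g : ℝ × E → Z} (hg : ∀ t y, g (t + T, y) = g (t, y))
    (hc : Continuous g) {y : ℕ → ℝ → E} {y₀ : ℝ → E} {C : ℝ} (hy : ∀ n t, ‖y n t‖ ≤ C)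
    (hy₀ : ∀ t, ‖y₀ t‖ ≤ C) (h : TendstoUniformly y y₀ atTop) :
    TendstoUniformly (fun n t => g (t, y n t)) (fun t => g (t, y₀ t)) atTop := by
  have huc := ((isCompact_Icc (a := 0) (b := T)).prod
    (isCompact_closedBall (0 : E) C)).uniformContinuousOn_of_continuous hc.continuousOn
  rw [Metric.uniformContinuousOn_iff] at huc
  rw [Metric.tendstoUniformly_iff] at h ⊢
  intro ε hε
  obtain ⟨δ, hδ, H⟩ := huc ε hε
  filter_upwards [h δ hδ] with n hn t
  obtain ⟨t', ht', e⟩ := exists_mem_period (g := fun t y => g (t, y)) hT hg t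
  rw [e, e]
  refine H (t', y₀ t) ⟨ht', by simpa using hy₀ t⟩ (t', y n t) ⟨ht', by simpa using hy n t⟩ ?_
  simpa [Prod.dist_eq, hδ] using hn t

variable {ι : Type*} [Fintype ι] [DecidableEq ι]

/-- The partial differential of `g` in the second variable, applied to `w`, is bounded by the sum of
the moduli of the partial derivatives. -/
theorem abs_le_sum_mul_norm (L : ℝ × (ι → ℝ) →L[ℝ] ℝ) (w : ι → ℝ) :
    |L (0, w)| ≤ (∑ k, |L (0, Pi.single k 1)|) * ‖w‖ := by
  have h : L (0, w) = ∑ k, w k * L (0, Pi.single k 1) := by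
    have := (L.comp (ContinuousLinearMap.inr ℝ ℝ (ι → ℝ))).toLinearMap.pi_apply_eq_sum_univ w
    simp only [ContinuousLinearMap.coe_coe, ContinuousLinearMap.comp_apply,
      ContinuousLinearMap.inr_apply, smul_eq_mul] at this
    rw [this]
    refine Finset.sum_congr rfl fun k _ => ?_
    congr 4
    ext i
    simp [Pi.single_apply, eq_comm]
  rw [h, Finset.sum_mul]
  refine (Finset.abs_sum_le_sum_abs _ _).trans (Finset.sum_le_sum fun k _ => ?_)
  rw [abs_mul, mul_comm]
  gcongr
  exact norm_le_pi_norm w k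

/-- Perturbed contraction: if `e (n+1) ≤ θ e n + o(1)` uniformly, with `θ < 1`, then `e n → 0`. -/
theorem tendstoUniformly_of_contraction {E : Type*} [NormedAddCommGroup E] {w : ℕ → ℝ → E}
    {w₀ : ℝ → E} {θ : ℝ} (hθ : 0 ≤ θ) (hθ1 : θ < 1)
    (hb : ∀ n, ∃ C, ∀ t, ‖w n t - w₀ t‖ ≤ C)
    (h : ∀ ε > 0, ∃ N, ∀ n ≥ N, ∀ C, (∀ t, ‖w n t - w₀ t‖ ≤ C) →
      ∀ t, ‖w (n + 1) t - w₀ t‖ ≤ θ * C + ε) :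
    TendstoUniformly w w₀ atTop := by
  rw [Metric.tendstoUniformly_iff]
  intro ε hε
  obtain ⟨N, hN⟩ := h ((1 - θ) * (ε / 2)) (by nlinarith)
  obtain ⟨C, hC⟩ := hb N
  have key : ∀ k, ∀ t, ‖w (N + k) t - w₀ t‖ ≤ θ ^ k * C + ε / 2 := by
    intro k
    induction k with
    | zero => intro t; have := hC t; simp only [add_zero, pow_zero, one_mul]; linarith
    | succ k ih =>
      intro t
      refine (hN (N + k) (by omega) _ ih t).trans (le_of_eq ?_)
      ring
  have ht : Tendsto (fun k => θ ^ k * C) atTop (𝓝 0) := by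
    simpa using (tendsto_pow_atTop_nhds_zero_of_lt_one hθ hθ1).mul_const C
  obtain ⟨k₀, hk₀⟩ := eventually_atTop.1 (ht.eventually (gt_mem_nhds (half_pos hε)))
  refine eventually_atTop.2 ⟨N + k₀, fun n hn t => ?_⟩
  obtain ⟨k, rfl⟩ := Nat.exists_eq_add_of_le (le_of_add_le_left hn)
  rw [dist_comm, dist_eq_norm]
  have := key k t
  have := hk₀ k (by omega)
  linarith

/-- The iterates, starting from zero, of `z t j = Ψ j (t, z (σ j t))`. -/
def picardIter (Ψ : ι → ℝ × (ι → ℝ) → ℝ) (σ : ι → ℝ → ℝ) : ℕ → ℝ → ι → ℝ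
  | 0 => fun _ => 0
  | n + 1 => fun t j => Ψ j (t, picardIter Ψ σ n (σ j t))

/-- A continuous periodic solution of `z t j = Ψ j (t, z (σ j t))` is `C¹` if the right-hand side
contracts in the supremum norm, and the equation for the derivative does so, too: both the iterates
starting from zero and their derivatives converge uniformly. -/
theorem contDiff_one_of_functional_eq {Ψ : ι → ℝ × (ι → ℝ) → ℝ} {σ : ι → ℝ → ℝ} {z : ℝ → ι → ℝ}
    {T : ℝ} (hT : 0 < T) (hΨ : ∀ j, ContDiff ℝ 1 (Ψ j)) (hσ : ∀ j, ContDiff ℝ 1 (σ j))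
    (hΨT : ∀ j t y, Ψ j (t + T, y) = Ψ j (t, y)) (hσT : ∀ j t, σ j (t + T) = σ j t + T)
    (hz : Continuous z) (hzT : ∀ t, z (t + T) = z t) (hzeq : ∀ t j, z t j = Ψ j (t, z (σ j t)))
    (h0 : ∀ j t y, ∑ k, |fderiv ℝ (Ψ j) (t, y) (0, Pi.single k 1)| < 1)
    (h1 : ∀ j t y, |deriv (σ j) t| * ∑ k, |fderiv ℝ (Ψ j) (t, y) (0, Pi.single k 1)| < 1) :
    ContDiff ℝ 1 z := by
  obtain ⟨M, hM0, hM⟩ := exists_bound_of_periodic hT hzT hz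
  set K : Set (ι → ℝ) := Metric.closedBall 0 (2 * M) with hKdef
  have hK : IsCompact K := isCompact_closedBall _ _
  have memK : ∀ {y : ι → ℝ}, y ∈ K ↔ ‖y‖ ≤ 2 * M := by simp [hKdef]
  have hDc : ∀ j, Continuous fun q => fderiv ℝ (Ψ j) q := fun j =>
    (hΨ j).continuous_fderiv one_ne_zero
  have hDT : ∀ j t y, fderiv ℝ (Ψ j) (t + T, y) = fderiv ℝ (Ψ j) (t, y) := fun j t y => by
    have e : Ψ j = fun q => Ψ j (q + (T, 0)) := by
      ext ⟨s, x⟩; simp [hΨT]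
    conv_rhs => rw [e]
    rw [fderiv_comp_add_right]
    simp
  have hsc : ∀ j, Continuous fun q => ∑ k, |fderiv ℝ (Ψ j) q (0, Pi.single k 1)| := fun j =>
    continuous_finsetSum _ fun k _ => ((hDc j).clm_apply continuous_const).abs
  have hσd : ∀ j t, HasDerivAt (σ j) (deriv (σ j) t) t := fun j t =>
    ((hσ j).differentiable one_ne_zero t).hasDerivAt
  have hσc : ∀ j, Continuous (deriv (σ j)) := fun j => (hσ j).continuous_deriv le_rfl
  have hσ'T : ∀ j t, deriv (σ j) (t + T) = deriv (σ j) t := fun j t => by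
    have := ((hσd j (t + T)).comp_add_const t T)
    simp only [hσT] at this
    simpa using (this.add_const (-T)).deriv.symm
  -- uniform contraction constants
  have unif : ∃ θ : ℝ, 0 ≤ θ ∧ θ < 1 ∧ ∀ j t, ∀ y ∈ K,
      (∑ k, |fderiv ℝ (Ψ j) (t, y) (0, Pi.single k 1)| ≤ θ) ∧
      |deriv (σ j) t| * ∑ k, |fderiv ℝ (Ψ j) (t, y) (0, Pi.single k 1)| ≤ θ := by
    choose θ₀ a₀ b₀ c₀ using fun j => exists_lt_one_of_periodic hT
      (g := fun q => ∑ k, |fderiv ℝ (Ψ j) q (0, Pi.single k 1)|)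
      (fun t y => by simp only [hDT]) (hsc j) hK (fun q => h0 j q.1 q.2)
    choose θ₁ a₁ b₁ c₁ using fun j => exists_lt_one_of_periodic hT
      (g := fun q => |deriv (σ j) q.1| * ∑ k, |fderiv ℝ (Ψ j) q (0, Pi.single k 1)|)
      (fun t y => by simp only [hDT, hσ'T])
      ((((hσc j).comp continuous_fst).abs).mul (hsc j)) hK (fun q => h1 j q.1 q.2)
    have hfin : ∃ θ : ℝ, 0 ≤ θ ∧ θ < 1 ∧ ∀ j, max (θ₀ j) (θ₁ j) ≤ θ := by
      rcases isEmpty_or_nonempty ι with hι | hι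
      · exact ⟨0, le_rfl, one_pos, fun j => (hι.false j).elim⟩
      · obtain ⟨j, hj⟩ := Finite.exists_max fun j => max (θ₀ j) (θ₁ j)
        exact ⟨_, (a₀ j).trans (le_max_left _ _), max_lt (b₀ j) (b₁ j), hj⟩
    obtain ⟨θ, hθ0, hθ1, hθ⟩ := hfin
    exact ⟨θ, hθ0, hθ1, fun j t y hy => ⟨(c₀ j t y hy).trans ((le_max_left _ _).trans (hθ j)),
      (c₁ j t y hy).trans ((le_max_right _ _).trans (hθ j))⟩⟩
  obtain ⟨θ, hθ0, hθ1, hθ⟩ := unif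
  have lip : ∀ j t, ∀ y ∈ K, ∀ y' ∈ K, |Ψ j (t, y) - Ψ j (t, y')| ≤ θ * ‖y - y'‖ := by
    intro j t y hy y' hy'
    have hd : ∀ x ∈ K, HasFDerivWithinAt (fun x => Ψ j (t, x))
        ((fderiv ℝ (Ψ j) (t, x)).comp (ContinuousLinearMap.inr ℝ ℝ (ι → ℝ))) K x := fun x _ =>
      (((hΨ j).differentiable one_ne_zero (t, x)).hasFDerivAt.comp x
        (hasFDerivAt_prodMk_right t x)).hasFDerivWithinAt
    refine (convex_closedBall _ _).norm_image_sub_le_of_norm_hasFDerivWithin_le hd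
      (fun x hx => ?_) hy' hy
    refine ContinuousLinearMap.opNorm_le_bound _ hθ0 fun w => ?_
    refine (abs_le_sum_mul_norm _ w).trans ?_
    gcongr
    exact (hθ j t x hx).1
  -- convergence of the iterates
  have hiter : ∀ n t, ‖picardIter Ψ σ n t - z t‖ ≤ θ ^ n * M ∧ picardIter Ψ σ n t ∈ K := by
    have inK : ∀ n, (∀ t, ‖picardIter Ψ σ n t - z t‖ ≤ θ ^ n * M) →
        ∀ t, picardIter Ψ σ n t ∈ K := fun n h t => by
      rw [memK]
      have h2 : θ ^ n * M ≤ M := mul_le_of_le_one_left hM0 (pow_le_one₀ hθ0 hθ1.le)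
      have h3 : ‖picardIter Ψ σ n t‖ ≤ ‖picardIter Ψ σ n t - z t‖ + ‖z t‖ := by
        simpa using norm_add_le (picardIter Ψ σ n t - z t) (z t)
      linarith [h t, hM t]
    have hn : ∀ n t, ‖picardIter Ψ σ n t - z t‖ ≤ θ ^ n * M := by
      intro n
      induction n with
      | zero => intro t; simpa [picardIter] using hM t
      | succ n ih =>
        intro t
        refine (pi_norm_le_iff_of_nonneg (by positivity)).2 fun j => ?_
        rw [Pi.sub_apply, hzeq t j, Real.norm_eq_abs]
        refine (lip j t _ (inK n ih _) _ (memK.2 ((hM _).trans (by linarith)))).trans ?_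
        rw [pow_succ', mul_assoc]
        gcongr
        exact ih _
    exact fun n t => ⟨hn n t, inK n (hn n) t⟩
  have hconv : TendstoUniformly (picardIter Ψ σ) z atTop := by
    rw [Metric.tendstoUniformly_iff]
    intro ε hε
    have ht : Tendsto (fun k => θ ^ k * M) atTop (𝓝 0) := by
      simpa using (tendsto_pow_atTop_nhds_zero_of_lt_one hθ0 hθ1).mul_const M
    filter_upwards [ht.eventually (gt_mem_nhds hε)] with n hn t
    rw [dist_comm, dist_eq_norm]
    exact (hiter n t).1.trans_lt hn
  have hsmooth : ∀ n, ContDiff ℝ 1 (picardIter Ψ σ n) := by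
    intro n
    induction n with
    | zero => exact contDiff_const
    | succ n ih =>
      exact contDiff_pi.2 fun j => (hΨ j).comp (contDiff_id.prodMk (ih.comp (hσ j)))
  have hper : ∀ n t, picardIter Ψ σ n (t + T) = picardIter Ψ σ n t := by
    intro n
    induction n with
    | zero => intro t; rfl
    | succ n ih => intro t; ext j; simp only [picardIter, hσT, ih, hΨT]
  set w : ℕ → ℝ → ι → ℝ := fun n => deriv (picardIter Ψ σ n) with hw
  have hwd : ∀ n t, HasDerivAt (picardIter Ψ σ n) (w n t) t := fun n t =>
    ((hsmooth n).differentiable one_ne_zero t).hasDerivAt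
  have hwc : ∀ n, Continuous (w n) := fun n => (hsmooth n).continuous_deriv le_rfl
  have hwT : ∀ n t, w n (t + T) = w n t := fun n t => by
    have := (hwd n (t + T)).comp_add_const t T
    simp only [hper] at this
    exact this.unique (hwd n t)
  -- the derivatives satisfy the linearized recursion
  have hwrec : ∀ n t j, w (n + 1) t j =
      fderiv ℝ (Ψ j) (t, picardIter Ψ σ n (σ j t)) (1, deriv (σ j) t • w n (σ j t)) := by
    intro n t j
    have e1 := hasDerivAt_pi.1 (hwd (n + 1) t) j
    have e2 : HasDerivAt (fun t => (t, picardIter Ψ σ n (σ j t)))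
        (1, deriv (σ j) t • w n (σ j t)) t :=
      (hasDerivAt_id t).prodMk ((hwd n (σ j t)).scomp t (hσd j t))
    have e3 := ((hΨ j).differentiable one_ne_zero
      (t, picardIter Ψ σ n (σ j t))).hasFDerivAt.comp_hasDerivAt t e2
    exact e1.unique e3
  have split : ∀ j q (r : ℝ) (y : ι → ℝ), fderiv ℝ (Ψ j) q (1, r • y) =
      fderiv ℝ (Ψ j) q (1, 0) + r * fderiv ℝ (Ψ j) q (0, y) := fun j q r y => by
    have : ((1 : ℝ), r • y) = (1, 0) + r • ((0 : ℝ), y) := by simp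
    rw [this, map_add, map_smul, smul_eq_mul]
  have split_sub : ∀ j q (r : ℝ) (x y : ι → ℝ), fderiv ℝ (Ψ j) q (1, r • x) -
      fderiv ℝ (Ψ j) q (1, r • y) = r * fderiv ℝ (Ψ j) q (0, x - y) := fun j q r x y => by
    have : ((0 : ℝ), x - y) = (0, x) - (0, y) := by simp
    rw [split, split, this, map_sub]
    ring
  have zK : ∀ t, z t ∈ K := fun t => memK.2 ((hM t).trans (by linarith))
  have contr : ∀ j t, ∀ y ∈ K, ∀ x : ι → ℝ,
      |deriv (σ j) t * fderiv ℝ (Ψ j) (t, y) (0, x)| ≤ θ * ‖x‖ := fun j t y hy x => by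
    rw [abs_mul]
    refine (mul_le_mul_of_nonneg_left (abs_le_sum_mul_norm _ x) (abs_nonneg _)).trans ?_
    rw [← mul_assoc]
    gcongr
    exact (hθ j t y hy).2
  -- the fixed point of the limit of these recursions
  have hw₀ : ∃ w₀ : ℝ → ι → ℝ, Continuous w₀ ∧ (∃ C, ∀ t, ‖w₀ t‖ ≤ C) ∧ ∀ t j, w₀ t j =
      fderiv ℝ (Ψ j) (t, z (σ j t)) (1, deriv (σ j) t • w₀ (σ j t)) := by
    have hqc : ∀ j, Continuous fun t => (t, z (σ j t)) := fun j =>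
      continuous_id.prodMk (hz.comp (hσ j).continuous)
    obtain ⟨C, hC0, hC⟩ := exists_bound_of_periodic hT
      (g := fun t j => fderiv ℝ (Ψ j) (t, z (σ j t)) (1, 0))
      (fun t => by ext j; simp only [hσT, hzT, hDT])
      (continuous_pi fun j => ((hDc j).comp (hqc j)).clm_apply continuous_const)
    let S : BoundedContinuousFunction ℝ (ι → ℝ) → BoundedContinuousFunction ℝ (ι → ℝ) := fun x =>
      BoundedContinuousFunction.ofNormedAddCommGroup
        (fun t j => fderiv ℝ (Ψ j) (t, z (σ j t)) (1, deriv (σ j) t • x (σ j t)))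
        (continuous_pi fun j => ((hDc j).comp (hqc j)).clm_apply
          (continuous_const.prodMk ((hσc j).smul (x.continuous.comp (hσ j).continuous))))
        (C + θ * ‖x‖) (fun t => by
          refine (pi_norm_le_iff_of_nonneg (by positivity)).2 fun j => ?_
          rw [split]
          refine (norm_add_le _ _).trans (add_le_add ((norm_le_pi_norm _ j).trans (hC t)) ?_)
          refine (contr j t _ (zK _) _).trans ?_
          gcongr
          exact x.norm_coe_le_norm _)
    have hS : ContractingWith θ.toNNReal S := by
      refine ⟨by rw [← NNReal.coe_lt_coe, Real.coe_toNNReal _ hθ0]; exact hθ1,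
        LipschitzWith.of_dist_le_mul fun x y => ?_⟩
      rw [Real.coe_toNNReal _ hθ0]
      refine (BoundedContinuousFunction.dist_le (by positivity)).2 fun t => ?_
      rw [dist_eq_norm]
      refine (pi_norm_le_iff_of_nonneg (by positivity)).2 fun j => ?_
      have : (S x t - S y t) j = deriv (σ j) t * fderiv ℝ (Ψ j) (t, z (σ j t))
          (0, x (σ j t) - y (σ j t)) := split_sub _ _ _ _ _
      rw [this]
      refine (contr j t _ (zK _) _).trans ?_
      gcongr
      rw [← dist_eq_norm]
      exact BoundedContinuousFunction.dist_coe_le_dist _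
    refine ⟨hS.fixedPoint, (hS.fixedPoint).continuous, ⟨_, fun t =>
      hS.fixedPoint.norm_coe_le_norm t⟩, fun t j => ?_⟩
    conv_lhs => rw [← hS.fixedPoint_isFixedPt]
    rfl
  obtain ⟨w₀, hw₀c, ⟨C₀, hC₀⟩, hw₀eq⟩ := hw₀
  have hwconv : TendstoUniformly w w₀ atTop := by
    refine tendstoUniformly_of_contraction hθ0 hθ1 (fun n => ?_) fun ε hε => ?_
    · obtain ⟨C, -, hC⟩ := exists_bound_of_periodic hT (hwT n) (hwc n)
      exact ⟨C + C₀, fun t => (norm_sub_le _ _).trans (add_le_add (hC t) (hC₀ t))⟩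
    have hsmall : ∀ j, ∀ᶠ n in atTop, ∀ t,
        ‖fderiv ℝ (Ψ j) (t, picardIter Ψ σ n (σ j t)) - fderiv ℝ (Ψ j) (t, z (σ j t))‖ *
          (1 + |deriv (σ j) t| * C₀) ≤ ε := by
      intro j
      obtain ⟨B, hB0, hB⟩ := exists_bound_of_periodic hT (hσ'T j) (hσc j)
      have hu := tendstoUniformly_comp_of_periodic hT (hDT j) (hDc j)
        (y := fun n t => picardIter Ψ σ n (σ j t)) (y₀ := fun t => z (σ j t)) (C := 2 * M)
        (fun n t => memK.1 (hiter n _).2) (fun t => memK.1 (zK _)) (hconv.comp (σ j))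
      have hC₀0 : 0 ≤ C₀ := (norm_nonneg _).trans (hC₀ 0)
      have hpos : 0 < 1 + B * C₀ := by positivity
      rw [Metric.tendstoUniformly_iff] at hu
      filter_upwards [hu (ε / (1 + B * C₀)) (by positivity)] with n hn t
      have h1 := hn t
      rw [dist_comm, dist_eq_norm] at h1
      calc _ ≤ ε / (1 + B * C₀) * (1 + B * C₀) := by
            gcongr
            exact hB t
        _ = ε := div_mul_cancel₀ _ hpos.ne'
    obtain ⟨N, hN⟩ := eventually_atTop.1 (eventually_all.2 hsmall)
    refine ⟨N, fun n hn C hC t => ?_⟩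
    have hC0 : 0 ≤ C := (norm_nonneg _).trans (hC 0)
    refine (pi_norm_le_iff_of_nonneg (by positivity)).2 fun j => ?_
    rw [Pi.sub_apply, hwrec, hw₀eq, Real.norm_eq_abs]
    set D := fderiv ℝ (Ψ j) (t, picardIter Ψ σ n (σ j t))
    set D₀ := fderiv ℝ (Ψ j) (t, z (σ j t))
    have e : D (1, deriv (σ j) t • w n (σ j t)) - D₀ (1, deriv (σ j) t • w₀ (σ j t)) =
        deriv (σ j) t * D (0, w n (σ j t) - w₀ (σ j t)) +
          (D - D₀) (1, deriv (σ j) t • w₀ (σ j t)) := by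
      rw [← split_sub, sub_apply]
      ring
    rw [e]
    refine (abs_add_le _ _).trans (add_le_add ?_ ?_)
    · refine (contr j t _ (hiter n _).2 _).trans ?_
      gcongr
      exact hC _
    · refine ((D - D₀).le_opNorm _).trans (le_trans ?_ (hN n hn j t))
      gcongr
      rw [Prod.norm_def, norm_one, norm_smul, Real.norm_eq_abs]
      have h5 : |deriv (σ j) t| * ‖w₀ (σ j t)‖ ≤ |deriv (σ j) t| * C₀ := by gcongr; exact hC₀ _
      have h6 : 0 ≤ |deriv (σ j) t| * ‖w₀ (σ j t)‖ := by positivity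
      exact max_le (by linarith) (by linarith)
  have hderiv : ∀ t, HasDerivAt z (w₀ t) t := hasDerivAt_of_tendstoUniformly hwconv
    (Eventually.of_forall hwd) fun t => hconv.tendsto_at t
  rw [contDiff_one_iff_deriv]
  refine ⟨fun t => (hderiv t).differentiableAt, ?_⟩
  rwa [show deriv z = w₀ from funext fun t => (hderiv t).deriv]

/-! ### Functions of class `C^s` on the strip -/

theorem uniqueDiffOn_strip : UniqueDiffOn ℝ strip :=
  uniqueDiffOn_Icc_zero_one.prod uniqueDiffOn_univ

theorem mem_strip {x t : ℝ} : (x, t) ∈ strip ↔ x ∈ Icc (0 : ℝ) 1 := by simp [strip]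

theorem clamp_mem_strip (x t : ℝ) : (clamp x, t) ∈ strip := mem_strip.2 (clamp_mem x)

theorem strip_mem_nhds {x : ℝ} (hx : x ∈ Ioo (0 : ℝ) 1) (t : ℝ) : strip ∈ 𝓝 (x, t) :=
  prod_mem_nhds (Icc_mem_nhds hx.1 hx.2) univ_mem

theorem continuous_clamp_strip {E : Type*} [TopologicalSpace E] {g : ℝ × ℝ → E}
    (hg : ContinuousOn g strip) : Continuous fun q : ℝ × ℝ => g (clamp q.1, q.2) :=
  hg.comp_continuous (by fun_prop) fun q => clamp_mem_strip q.1 q.2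

theorem timeC1_clamp {p : ℝ × ℝ → ℝ} (hp : ContDiffOn ℝ 1 p strip) :
    TimeC1 (fun q => p (clamp q.1, q.2))
      (fun q => fderivWithin ℝ p strip (clamp q.1, q.2) (0, 1)) := by
  refine ⟨continuous_clamp_strip hp.continuousOn, (continuous_clamp_strip
    (hp.continuousOn_fderivWithin uniqueDiffOn_strip le_rfl)).clm_apply continuous_const,
    fun x t => ?_⟩
  have h := (hp.differentiableOn one_ne_zero _ (clamp_mem_strip x t)).hasFDerivWithinAt
  have h2 : HasDerivWithinAt (fun s => (clamp x, s)) ((0 : ℝ), (1 : ℝ)) univ t :=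
    ((hasDerivAt_const t (clamp x)).prodMk (hasDerivAt_id t)).hasDerivWithinAt
  exact hasDerivWithinAt_univ.1 (h.comp_hasDerivWithinAt t h2 fun s _ => clamp_mem_strip x s)

theorem hasDerivAt_clamp_curve {p : ℝ × ℝ → ℝ} (hp : ContDiffOn ℝ 1 p strip) {τ : ℝ → ℝ}
    {τ' ξ : ℝ} (hξ : ξ ∈ Ioo (0 : ℝ) 1) (hτ : HasDerivAt τ τ' ξ) :
    HasDerivAt (fun x => p (clamp x, τ x))
      (fderivWithin ℝ p strip (clamp ξ, τ ξ) (1, τ')) ξ := by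
  have hξ' : ξ ∈ Icc (0 : ℝ) 1 := ⟨hξ.1.le, hξ.2.le⟩
  have h : HasFDerivAt p (fderivWithin ℝ p strip (ξ, τ ξ)) (ξ, τ ξ) :=
    (hp.differentiableOn one_ne_zero _ (mem_strip.2 hξ')).hasFDerivWithinAt.hasFDerivAt
      (strip_mem_nhds hξ _)
  have h2 := h.comp_hasDerivAt ξ ((hasDerivAt_id ξ).prodMk hτ)
  rw [clamp_of_mem hξ']
  refine h2.congr_of_eventuallyEq ?_
  filter_upwards [Ioo_mem_nhds hξ.1 hξ.2] with x hx
  simp [clamp_of_mem ⟨hx.1.le, hx.2.le⟩]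

/-- `g` is of class `C^s` on the strip and `2π`-periodic in time, and it is extended to the plane
constantly in the space variable. -/
structure Reg (s : WithTop ℕ∞) (g : ℝ × ℝ → ℝ) : Prop where
  contDiffOn : ContDiffOn ℝ s g strip
  clamp_eq : ∀ x t, g (clamp x, t) = g (x, t)
  periodic : ∀ x t, g (x, t + 2 * Real.pi) = g (x, t)

namespace Reg

variable {s : WithTop ℕ∞} {g k : ℝ × ℝ → ℝ}

theorem of_le {s' : WithTop ℕ∞} (hg : Reg s g) (h : s' ≤ s) : Reg s' g :=
  ⟨hg.contDiffOn.of_le h, hg.clamp_eq, hg.periodic⟩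

theorem continuous (hg : Reg s g) : Continuous g := by
  simpa only [hg.clamp_eq] using continuous_clamp_strip hg.contDiffOn.continuousOn

theorem add (hg : Reg s g) (hk : Reg s k) : Reg s fun q => g q + k q :=
  ⟨hg.contDiffOn.add hk.contDiffOn, fun x t => by simp only [hg.clamp_eq, hk.clamp_eq],
    fun x t => by simp only [hg.periodic, hk.periodic]⟩

theorem sub (hg : Reg s g) (hk : Reg s k) : Reg s fun q => g q - k q :=
  ⟨hg.contDiffOn.sub hk.contDiffOn, fun x t => by simp only [hg.clamp_eq, hk.clamp_eq],
    fun x t => by simp only [hg.periodic, hk.periodic]⟩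

theorem mul (hg : Reg s g) (hk : Reg s k) : Reg s fun q => g q * k q :=
  ⟨hg.contDiffOn.mul hk.contDiffOn, fun x t => by simp only [hg.clamp_eq, hk.clamp_eq],
    fun x t => by simp only [hg.periodic, hk.periodic]⟩

theorem sum {ι : Type*} {S : Finset ι} {G : ι → ℝ × ℝ → ℝ} (h : ∀ i ∈ S, Reg s (G i)) :
    Reg s fun q => ∑ i ∈ S, G i q :=
  ⟨ContDiffOn.sum fun i hi => (h i hi).contDiffOn,
    fun x t => Finset.sum_congr rfl fun i hi => (h i hi).clamp_eq x t,
    fun x t => Finset.sum_congr rfl fun i hi => (h i hi).periodic x t⟩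

theorem dt_eq (hg : Reg s g) (hs : 1 ≤ s) (x t : ℝ) :
    dt g (x, t) = fderivWithin ℝ g strip (clamp x, t) (0, 1) := by
  have h := (timeC1_clamp (hg.contDiffOn.of_le hs)).hasDerivAt x t
  simp only [hg.clamp_eq] at h
  exact h.deriv

theorem timeC1 (hg : Reg s g) (hs : 1 ≤ s) : TimeC1 g (dt g) := by
  have h := timeC1_clamp (hg.contDiffOn.of_le hs)
  simp only [hg.clamp_eq] at h
  rwa [show dt g = fun q => fderivWithin ℝ g strip (clamp q.1, q.2) (0, 1) from
    funext fun q => hg.dt_eq hs q.1 q.2]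

theorem exists_bound (hg : Reg s g) : ∃ C, ∀ q, |g q| ≤ C := by
  obtain ⟨C, hC⟩ := ((isCompact_Icc (a := (0 : ℝ)) (b := 1)).prod
    (isCompact_Icc (a := 0) (b := 2 * Real.pi))).exists_bound_of_continuousOn
    hg.continuous.continuousOn
  refine ⟨C, fun q => ?_⟩
  obtain ⟨t, ht, h⟩ := exists_mem_period (g := fun t x => g (x, t)) Real.two_pi_pos
    (fun t x => hg.periodic x t) q.2
  have h1 := h (clamp q.1)
  simp only [hg.clamp_eq q.1 q.2] at h1
  rw [show g q = g (clamp q.1, t) from h1]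
  exact hC (clamp q.1, t) ⟨clamp_mem _, ht⟩

end Reg

theorem dt_clamp {g : ℝ × ℝ → ℝ} (hg : ∀ x t, g (clamp x, t) = g (x, t)) (x t : ℝ) :
    dt g (clamp x, t) = dt g (x, t) := by simp only [dt, hg]

theorem dt_periodic {g : ℝ × ℝ → ℝ} {T : ℝ} (hg : ∀ x t, g (x, t + T) = g (x, t)) (x t : ℝ) :
    dt g (x, t + T) = dt g (x, t) := by
  simp only [dt]
  rw [← deriv_comp_add_const]
  simp only [hg]

theorem Reg.dt {s s' : WithTop ℕ∞} {g : ℝ × ℝ → ℝ} (hg : Reg s g) (hs : s' + 1 ≤ s) :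
    Reg s' (dt g) := by
  refine ⟨?_, dt_clamp hg.clamp_eq, dt_periodic hg.periodic⟩
  have h := (hg.contDiffOn.fderivWithin uniqueDiffOn_strip hs).clm_apply
    (contDiffOn_const (c := ((0 : ℝ), (1 : ℝ))))
  refine h.congr fun q hq => ?_
  obtain ⟨x, t⟩ := q
  rw [hg.dt_eq (le_add_self.trans hs), clamp_of_mem (mem_strip.1 hq)]

theorem Reg.isSlope {F : ℝ × ℝ → ℝ} (hF : Reg ∞ F) : IsSlope F (DissipativeHyperbolic.dt F) where
  toTimeC1 := hF.timeC1 (by norm_num)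
  bdd := hF.exists_bound
  bdd' := (hF.dt (s' := ∞) (by simp)).exists_bound

/-! ### Functions transported along the characteristics -/

/-- Along the integral curves of the slope field `F`, the function `v` has the derivative `q`. -/
def IsTransported (F v q : ℝ × ℝ → ℝ) : Prop :=
  ∀ w, IsIntegral F w → ∀ ξ ∈ Icc (0 : ℝ) 1,
    HasDerivWithinAt (fun x => v (x, w x)) (q (ξ, w ξ)) (Icc 0 1) ξ

section

variable {F F' v v' q q' : ℝ × ℝ → ℝ}

/-- A coupling term `p (F - F₂) v₂`, with `v₂` transported along `F₂`, gains a time derivative upon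
integration along the characteristics of `F`: these are transversal to the ones of `F₂` where the
coefficient does not vanish. -/
theorem exists_timeC1_integral_coupling {F₂ F₂' M Ms Mx p : ℝ × ℝ → ℝ} (hF : IsSlope F F')
    (hF₂ : IsSlope F₂ F₂') (hM : TimeC1 M Ms) (hMx : Continuous Mx)
    (hMd : ∀ ξ ∈ Ioo (0 : ℝ) 1, ∀ s, HasDerivAt (fun ξ => M (ξ, s)) (Mx (ξ, s)) ξ)
    (hp : ContDiffOn ℝ 1 p strip) (hv : Continuous v) (hq : Continuous q)
    (hvq : IsTransported F₂ v q) {e : ℝ} (he : e ∈ Icc (0 : ℝ) 1) :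
    ∃ D, TimeC1 (fun z => ∫ ξ in e..clamp z.1, M (ξ, z.2) *
      (p (clamp ξ, flow F ξ e z.2) * (F (ξ, flow F ξ e z.2) - F₂ (ξ, flow F ξ e z.2)) *
        v (ξ, flow F ξ e z.2))) D := by
  have hW := hF.timeC1_flow e
  have hW₂ := hF₂.timeC1_flow 0
  have graph : ∀ {g w : ℝ × ℝ → ℝ}, Continuous g → Continuous w →
      Continuous fun z : ℝ × ℝ => g (z.1, w z) := fun hg hw =>
    hg.comp (continuous_fst.prodMk hw)
  have hWd : ∀ ξ ∈ Ioo (0 : ℝ) 1, ∀ s, HasDerivAt (fun ξ => flow F ξ e s)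
      (F (ξ, flow F ξ e s)) ξ := fun ξ hξ s =>
    (hF.isIntegral_flow e s ξ ⟨hξ.1.le, hξ.2.le⟩).hasDerivAt (Icc_mem_nhds hξ.1 hξ.2)
  have hfp := continuous_clamp_strip (hp.continuousOn_fderivWithin uniqueDiffOn_strip le_rfl)
  have hθ := (hF₂.timeC1_flow_foot 0).comp hW
  have hNx : Continuous fun z : ℝ × ℝ => Mx z * p (clamp z.1, flow F z.1 e z.2) + M z *
      fderivWithin ℝ p strip (clamp z.1, flow F z.1 e z.2) (1, F (z.1, flow F z.1 e z.2)) :=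
    (hMx.mul ((timeC1_clamp hp).comp hW).cont).add (hM.cont.mul
      ((hfp.comp (continuous_fst.prodMk hW.cont)).clm_apply
        (continuous_const.prodMk (graph hF.cont hW.cont))))
  have hQ : Continuous fun z : ℝ × ℝ =>
      q (z.1, flow F₂ z.1 0 z.2) * flowDeriv F₂ F₂' z.1 0 z.2 + v (z.1, flow F₂ z.1 0 z.2) *
        (flowDeriv F₂ F₂' z.1 0 z.2 * F₂' (z.1, flow F₂ z.1 0 z.2)) :=
    ((graph hq hW₂.cont).mul hW₂.cont').add
      ((graph hv hW₂.cont).mul (hW₂.cont'.mul (graph hF₂.cont' hW₂.cont)))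
  have hθx : Continuous fun z : ℝ × ℝ => flowDeriv F₂ F₂' 0 z.1 (flow F z.1 e z.2) *
      (F (z.1, flow F z.1 e z.2) - F₂ (z.1, flow F z.1 e z.2)) :=
    (graph (hF₂.timeC1_flow_foot 0).cont' hW.cont).mul
      ((graph hF.cont hW.cont).sub (graph hF₂.cont hW.cont))
  have hIcc : ∀ ξ ∈ Ioo (0 : ℝ) 1, ξ ∈ Icc (0 : ℝ) 1 := fun ξ hξ => ⟨hξ.1.le, hξ.2.le⟩
  have hV : Continuous fun z : ℝ × ℝ =>
      v (z.1, flow F₂ z.1 0 z.2) * flowDeriv F₂ F₂' z.1 0 z.2 :=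
    (graph hv hW₂.cont).mul hW₂.cont'
  have key := timeC1_integral_transversal (hM.mul ((timeC1_clamp hp).comp hW)) hNx
    (fun ξ hξ s => (hMd ξ hξ s).mul (hasDerivAt_clamp_curve hp hξ (hWd ξ hξ s)))
    hV hQ
    (fun ξ hξ s => ((hvq _ (hF₂.isIntegral_flow 0 s) ξ (hIcc ξ hξ)).mul
      (hF₂.hasDerivWithinAt_flowDeriv 0 s (hIcc ξ hξ))).hasDerivAt (Icc_mem_nhds hξ.1 hξ.2))
    hθ hθx
    (fun ξ hξ s => (hF₂.hasDerivWithinAt_flow_comp 0 (hIcc ξ hξ)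
      (hWd ξ hξ s).hasDerivWithinAt).hasDerivAt (Icc_mem_nhds hξ.1 hξ.2)) he
  refine ⟨_, key.congr fun z => intervalIntegral.integral_congr fun ξ _ => ?_⟩
  have h1 := hF₂.flowDeriv_mul_flowDeriv ξ 0 (flow F ξ e z.2)
  simp only [hF₂.flow_flow, hF₂.flow_self]
  linear_combination (-(M (ξ, z.2) * p (clamp ξ, flow F ξ e z.2) *
    (F (ξ, flow F ξ e z.2) - F₂ (ξ, flow F ξ e z.2)) * v (ξ, flow F ξ e z.2))) * h1

/-- The time derivative of a transported function is transported. -/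
theorem IsTransported.deriv (hF : IsSlope F F') (h : IsTransported F v q) (hv : TimeC1 v v')
    (hq : TimeC1 q q') : IsTransported F v' fun z => q' z - F' z * v' z := by
  intro w hw ξ hξ
  have h0 : (0 : ℝ) ∈ Icc (0 : ℝ) 1 := ⟨le_rfl, zero_le_one⟩
  have hwf : ∀ x ∈ Icc (0 : ℝ) 1, w x = flow F x 0 (w 0) := fun x hx => (hF.flow_eq hw h0 hx).symm
  have hW := hF.timeC1_flow 0
  have hvW := hv.comp hW
  have hqW := hq.comp hW
  have hcl : ∀ s, Continuous fun x => q (x, flow F x 0 s) := fun s =>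
    hqW.cont.comp (by fun_prop : Continuous fun x : ℝ => (x, s))
  have hcl' : ∀ s, Continuous fun x => q' (x, flow F x 0 s) * flowDeriv F F' x 0 s := fun s =>
    hqW.cont'.comp (by fun_prop : Continuous fun x : ℝ => (x, s))
  have hint : ∀ x ∈ Icc (0 : ℝ) 1, ∀ s, v (x, flow F x 0 s) =
      v (0, s) + ∫ η in (0 : ℝ)..x, q (η, flow F η 0 s) := fun x hx s => by
    have ht := h _ (hF.isIntegral_flow 0 s)
    have := intervalIntegral.integral_eq_sub_of_hasDeriv_right (a := 0) (b := x)
      (f := fun x => v (x, flow F x 0 s)) (f' := fun x => q (x, flow F x 0 s))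
      (hvW.cont.comp (by fun_prop : Continuous fun x : ℝ => (x, s))).continuousOn
      (fun η hη => by
        have hη' := Ioo_min_max_subset_unit h0 hx hη
        exact ((ht η ⟨hη'.1.le, hη'.2.le⟩).hasDerivAt
          (Icc_mem_nhds hη'.1 hη'.2)).hasDerivWithinAt)
      ((hcl s).intervalIntegrable _ _)
    rw [this, hF.flow_self]
    ring
  have hdiff : ∀ x ∈ Icc (0 : ℝ) 1, ∀ s, v' (x, flow F x 0 s) * flowDeriv F F' x 0 s =
      v' (0, s) + ∫ η in (0 : ℝ)..x, q' (η, flow F η 0 s) * flowDeriv F F' η 0 s :=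
    fun x hx s => by
    have h1 := hvW.hasDerivAt x s
    have h2 := (hv.hasDerivAt 0 s).add ((hqW.integral 0).hasDerivAt x s)
    refine h1.unique (h2.congr_of_eventuallyEq (Eventually.of_forall fun r => ?_))
    exact hint x hx r
  set s := w 0
  have hJ : ∀ x, flowDeriv F F' x 0 s ≠ 0 := fun x => (Real.exp_pos _).ne'
  have hnum : HasDerivAt (fun x => v' (0, s) +
      ∫ η in (0 : ℝ)..x, q' (η, flow F η 0 s) * flowDeriv F F' η 0 s)
      (q' (ξ, flow F ξ 0 s) * flowDeriv F F' ξ 0 s) ξ :=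
    (intervalIntegral.integral_hasDerivAt_right ((hcl' s).intervalIntegrable _ _)
      ((hcl' s).stronglyMeasurableAtFilter _ _) (hcl' s).continuousAt).const_add _
  have hquot := hnum.hasDerivWithinAt.div (hF.hasDerivWithinAt_flowDeriv 0 s hξ) (hJ ξ)
  have hval : ∀ x ∈ Icc (0 : ℝ) 1, v' (x, w x) = (v' (0, s) +
      ∫ η in (0 : ℝ)..x, q' (η, flow F η 0 s) * flowDeriv F F' η 0 s) / flowDeriv F F' x 0 s :=
    fun x hx => by rw [← hdiff x hx s, mul_div_cancel_right₀ _ (hJ x), hwf x hx]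
  refine (hquot.congr_of_mem hval hξ).congr_deriv ?_
  rw [← hdiff ξ hξ s, hwf ξ hξ]
  have := hJ ξ
  field_simp

/-- A function with a time derivative and a derivative along the characteristics is differentiable
on the strip. -/
theorem IsTransported.hasFDerivWithinAt (hF : IsSlope F F') (h : IsTransported F v q)
    (hv : TimeC1 v v') {z : ℝ × ℝ} (hz : z ∈ strip) :
    HasFDerivWithinAt v ((q z - F z * v' z) • ContinuousLinearMap.fst ℝ ℝ ℝ +
      v' z • ContinuousLinearMap.snd ℝ ℝ ℝ) strip z := by
  obtain ⟨x, t⟩ := z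
  have hx := mem_strip.1 hz
  have hw := hF.isIntegral_flow x t
  have hfst : HasFDerivWithinAt (fun y : ℝ × ℝ => y.1) (ContinuousLinearMap.fst ℝ ℝ ℝ) strip (x, t) :=
    hasFDerivWithinAt_fst
  have along := (h _ hw x hx).hasFDerivWithinAt.comp (x, t) hfst fun y hy => hy.1
  have foot := (hw x hx).hasFDerivWithinAt.comp (x, t) hfst fun y hy => hy.1
  have hd := (hasFDerivWithinAt_snd (𝕜 := ℝ) (p := (x, t)) (s := strip)).sub foot
  have hA : ContinuousWithinAt (fun y : ℝ × ℝ => timeMean v' y.1 y.2 (flow F y.1 x t)) strip (x, t) :=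
    ((continuous_timeMean hv.cont').comp (continuous_fst.prodMk (continuous_snd.prodMk
      ((hF.continuous_flow_left x t).comp continuous_fst)))).continuousWithinAt
  have hmul := hasFDerivWithinAt_mul_of_eq_zero hA hd (by simp [hF.flow_self])
  have hval : ∀ y : ℝ × ℝ, v y = v (y.1, flow F y.1 x t) +
      timeMean v' y.1 y.2 (flow F y.1 x t) * (y.2 - flow F y.1 x t) := fun y => by
    linarith [hv.sub_eq y.1 y.2 (flow F y.1 x t)]
  have := (along.add hmul).congr (f₁ := v) (fun y _ => hval y) (hval (x, t))
  refine this.congr_fderiv ?_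
  ext <;> simp [hF.flow_self, timeMean_self]
  ring

theorem IsTransported.contDiffOn_succ {s : ℕ} (hF : IsSlope F F') (h : IsTransported F v q)
    (hv : TimeC1 v v') (hFs : ContDiffOn ℝ s F strip) (hqs : ContDiffOn ℝ s q strip)
    (hvs : ContDiffOn ℝ s v' strip) : ContDiffOn ℝ (s + 1) v strip := by
  rw [contDiffOn_succ_iff_hasFDerivWithinAt_of_uniqueDiffOn uniqueDiffOn_strip]
  refine ⟨fun hn => ?_, _, ?_, fun z hz => h.hasFDerivWithinAt hF hv hz⟩
  · exact absurd hn (by simp)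
  · exact ((hqs.sub (hFs.mul hvs)).smul contDiffOn_const).add (hvs.smul contDiffOn_const)

end

/-! ### Hyperbolic systems with dissipative boundary conditions -/

variable {ι : Type*} [Fintype ι]

/-- The traces of `v` at the ends where the characteristics leave the strip; `e` are the abscissas
of the ends where they enter it. -/
def exitTrace (e : ι → ℝ) (v : ι → ℝ × ℝ → ℝ) (t : ℝ) : ι → ℝ := fun k => v k (1 - e k, t)

/-- The derivative of the component `v j` along its characteristics, as given by the system. -/
def slopeRhs (β : ι → ι → ℝ × ℝ → ℝ) (G v : ι → ℝ × ℝ → ℝ) (j : ι) (q : ℝ × ℝ) : ℝ :=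
  G j q - ∑ k, β j k q * v k q

variable [DecidableEq ι]

/-- `v` is a continuous solution of `∂ₓ v_j + F_j ∂ₜ v_j + ∑ β_jk v_k = G_j`, a system solved for
the space derivatives, with the boundary condition `v_j = Φ_j(t, z(t))` at the entry `e_j`, where
`z` is the exit trace of `v`. The equations hold along the characteristics. The data `G` and `Φ`
are of class `C^s`, and the boundary condition contracts up to the order `s`. The explicit time
dependence of `Φ` makes the class stable under differentiation in time. -/
structure IsDissipativeSolution (s : ℕ) (e : ι → ℝ) (F : ι → ℝ × ℝ → ℝ) (β : ι → ι → ℝ × ℝ → ℝ)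
    (G : ι → ℝ × ℝ → ℝ) (Φ : ι → ℝ × (ι → ℝ) → ℝ) (v : ι → ℝ × ℝ → ℝ) : Prop where
  entry : ∀ j, e j = 0 ∨ e j = 1
  slope : ∀ j, Reg ∞ (F j)
  coeff : ∀ j k, Reg ∞ (β j k)
  source : ∀ j, Reg s (G j)
  contDiff : ∀ j, ContDiff ℝ s (Φ j)
  periodic : ∀ j t y, Φ j (t + 2 * Real.pi, y) = Φ j (t, y)
  levy : ∀ j k, j ≠ k → ∃ p : ℝ × ℝ → ℝ, ContDiffOn ℝ 1 p strip ∧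
    ∀ q ∈ strip, β j k q = p q * (F j q - F k q)
  contraction : ∀ l : ℕ, l ≤ s → ∀ j t y, Real.exp (∫ η in (1 - e j)..(e j),
      (β j j (η, flow (F j) η (1 - e j) t) + l * dt (F j) (η, flow (F j) η (1 - e j) t))) *
    ∑ k, |fderiv ℝ (fun y => Φ j (flow (F j) (e j) (1 - e j) t, y)) y (Pi.single k 1)| < 1
  reg : ∀ j, Reg 0 (v j)
  transported : ∀ j, IsTransported (F j) (v j) (slopeRhs β G v j)
  boundary : ∀ j t, v j (e j, t) = Φ j (t, exitTrace e v t)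

namespace IsDissipativeSolution

variable {s : ℕ} {e : ι → ℝ} {F : ι → ℝ × ℝ → ℝ} {β : ι → ι → ℝ × ℝ → ℝ}
  {G : ι → ℝ × ℝ → ℝ} {Φ : ι → ℝ × (ι → ℝ) → ℝ} {v : ι → ℝ × ℝ → ℝ}

theorem of_le {s' : ℕ} (H : IsDissipativeSolution s e F β G Φ v) (h : s' ≤ s) :
    IsDissipativeSolution s' e F β G Φ v :=
  { H with
    source := fun j => (H.source j).of_le (by exact_mod_cast h)
    contDiff := fun j => (H.contDiff j).of_le (by exact_mod_cast h)
    contraction := fun l hl => H.contraction l (hl.trans h) }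

theorem entry_mem (H : IsDissipativeSolution s e F β G Φ v) (j : ι) : e j ∈ Icc (0 : ℝ) 1 := by
  rcases H.entry j with h | h <;> rw [h] <;> norm_num

theorem exit_mem (H : IsDissipativeSolution s e F β G Φ v) (j : ι) :
    1 - e j ∈ Icc (0 : ℝ) 1 :=
  ⟨by linarith [(H.entry_mem j).2], by linarith [(H.entry_mem j).1]⟩

theorem isSlope (H : IsDissipativeSolution s e F β G Φ v) (j : ι) :
    IsSlope (F j) (dt (F j)) := (H.slope j).isSlope

theorem coeff_timeC1 (H : IsDissipativeSolution s e F β G Φ v) (j k : ι) :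
    TimeC1 (β j k) (dt (β j k)) := (H.coeff j k).timeC1 (by norm_num)

theorem continuous_slopeRhs (H : IsDissipativeSolution s e F β G Φ v) (j : ι) :
    Continuous (slopeRhs β G v j) :=
  (H.source j).continuous.sub
    (continuous_finsetSum _ fun k _ => (H.coeff j k).continuous.mul (H.reg k).continuous)

theorem continuous_exitTrace (H : IsDissipativeSolution s e F β G Φ v) :
    Continuous (exitTrace e v) :=
  continuous_pi fun k => (H.reg k).continuous.comp (by fun_prop)

/-- Along the characteristics, a component is the propagated boundary value plus a term that is
differentiable in time, owing to the gain of regularity of the coupling integrals. -/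
theorem exists_timeC1_remainder (H : IsDissipativeSolution 1 e F β G Φ v) (j : ι) :
    ∃ ρ ρ', TimeC1 ρ ρ' ∧ ∀ x s, v j (x, flow (F j) x (e j) s) =
      Real.exp (-∫ η in (e j)..(clamp x), β j j (η, flow (F j) η (e j) s)) *
        Φ j (s, exitTrace e v s) + ρ (x, s) := by
  have hF := H.isSlope j
  have he := H.entry_mem j
  have hW := hF.timeC1_flow (e j)
  have hβW := (H.coeff_timeC1 j j).comp hW
  have hB := hβW.integral (e j)
  have hM := hB.exp
  have hclamp := hB.comp_space continuous_clamp
  have hS := (hM.mul (((H.source j).timeC1 le_rfl).comp hW)).integral (e j)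
    |>.comp_space continuous_clamp
  have hMd : ∀ ξ s, HasDerivAt (fun ξ =>
      Real.exp (∫ η in (e j)..ξ, β j j (η, flow (F j) η (e j) s)))
      (Real.exp (∫ η in (e j)..ξ, β j j (η, flow (F j) η (e j) s)) *
        β j j (ξ, flow (F j) ξ (e j) s)) ξ := fun ξ s => by
    have hc : Continuous fun η => β j j (η, flow (F j) η (e j) s) :=
      hβW.cont.comp (by fun_prop : Continuous fun η : ℝ => (η, s))
    exact (intervalIntegral.integral_hasDerivAt_right (hc.intervalIntegrable _ _)
      (hc.stronglyMeasurableAtFilter _ _) hc.continuousAt).exp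
  have hC : ∀ k, ∃ D, k ≠ j → TimeC1 (fun z => ∫ ξ in (e j)..clamp z.1,
      Real.exp (∫ η in (e j)..ξ, β j j (η, flow (F j) η (e j) z.2)) *
        (β j k (ξ, flow (F j) ξ (e j) z.2) * v k (ξ, flow (F j) ξ (e j) z.2))) D := fun k => by
    by_cases hk : k = j
    · exact ⟨0, fun h => absurd hk h⟩
    obtain ⟨p, hp, hpβ⟩ := H.levy j k (Ne.symm hk)
    obtain ⟨D, hD⟩ := exists_timeC1_integral_coupling hF (H.isSlope k) hM
      (hM.cont.mul hβW.cont) (fun ξ _ s => hMd ξ s) hp (H.reg k).continuous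
      (H.continuous_slopeRhs k) (H.transported k) he
    refine ⟨D, fun _ => hD.congr fun z => intervalIntegral.integral_congr fun ξ hξ => ?_⟩
    have hξ' := uIcc_subset_unit he (clamp_mem z.1) hξ
    simp only [hpβ _ (mem_strip.2 hξ'), clamp_of_mem hξ']
  choose D hD using hC
  have hsum := TimeC1.sum (s := Finset.univ.erase j) fun k hk => hD k (Finset.ne_of_mem_erase hk)
  refine ⟨_, _, hclamp.neg.exp.mul (hS.sub hsum), fun x s => ?_⟩
  -- variation of constants along the characteristic
  have hc : Continuous fun ξ : ℝ => (ξ, s) := by fun_prop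
  have hgc : Continuous fun q : ℝ × ℝ => G j (q.1, flow (F j) q.1 (e j) q.2) -
      ∑ k ∈ Finset.univ.erase j, β j k (q.1, flow (F j) q.1 (e j) q.2) *
        v k (q.1, flow (F j) q.1 (e j) q.2) :=
    ((H.source j).continuous.comp (continuous_fst.prodMk hW.cont)).sub
      (continuous_finsetSum _ fun k _ =>
        ((H.coeff j k).continuous.comp (continuous_fst.prodMk hW.cont)).mul
          ((H.reg k).continuous.comp (continuous_fst.prodMk hW.cont)))
  have hvoc := eq_of_linear_ode (y := fun ξ => v j (ξ, flow (F j) ξ (e j) s))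
    (β := fun ξ => -β j j (ξ, flow (F j) ξ (e j) s))
    (g := fun ξ => G j (ξ, flow (F j) ξ (e j) s) - ∑ k ∈ Finset.univ.erase j,
      β j k (ξ, flow (F j) ξ (e j) s) * v k (ξ, flow (F j) ξ (e j) s))
    (hβW.cont.comp hc).neg (hgc.comp hc) (fun ξ hξ => by
      refine (H.transported j _ (hF.isIntegral_flow (e j) s) ξ hξ).congr_deriv ?_
      rw [slopeRhs, ← Finset.add_sum_erase _ _ (Finset.mem_univ j)]
      ring) he (clamp_mem x)
  simp only [intervalIntegral.integral_neg, neg_neg, hF.flow_self, H.boundary, flow_clamp_left,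
    (H.reg j).clamp_eq] at hvoc
  rw [hvoc, mul_add]
  congr 2
  have hMc : Continuous fun ξ => Real.exp (∫ η in (e j)..ξ, β j j (η, flow (F j) η (e j) s)) :=
    hM.cont.comp hc
  have hvk : ∀ k, Continuous fun ξ =>
      β j k (ξ, flow (F j) ξ (e j) s) * v k (ξ, flow (F j) ξ (e j) s) := fun k =>
    (((H.coeff j k).continuous.comp (continuous_fst.prodMk hW.cont)).mul
      ((H.reg k).continuous.comp (continuous_fst.prodMk hW.cont))).comp hc
  rw [← intervalIntegral.integral_finsetSum, ← intervalIntegral.integral_sub]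
  · refine intervalIntegral.integral_congr fun ξ _ => ?_
    simp only [mul_sub, Finset.mul_sum]
  · exact (hMc.mul (((H.source j).continuous.comp
      (continuous_fst.prodMk hW.cont)).comp hc)).intervalIntegrable _ _
  · exact (continuous_finsetSum _ fun k _ => hMc.mul (hvk k)).intervalIntegrable _ _
  · exact fun k _ => (hMc.mul (hvk k)).intervalIntegrable _ _

/-- The exit trace is differentiable, because it solves a contractive functional equation. -/
theorem contDiff_exitTrace (H : IsDissipativeSolution 1 e F β G Φ v) :
    ContDiff ℝ 1 (exitTrace e v) := by
  choose ρ ρ' hρ hv using H.exists_timeC1_remainder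
  set E : ι → ℝ × ℝ → ℝ := fun j q =>
    Real.exp (-∫ η in (e j)..(clamp q.1), β j j (η, flow (F j) η (e j) q.2)) with hEdef
  have hE : ∀ j, ∃ E', TimeC1 (E j) E' := fun j =>
    ⟨_, ((((H.coeff_timeC1 j j).comp ((H.isSlope j).timeC1_flow (e j))).integral
      (e j)).comp_space continuous_clamp).neg.exp⟩
  choose E' hE' using hE
  set σ : ι → ℝ → ℝ := fun j t => flow (F j) (e j) (1 - e j) t with hσdef
  have hσ : ∀ j, ContDiff ℝ 1 (σ j) := fun j => ((H.isSlope j).timeC1_flow (1 - e j)).contDiff (e j)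
  have hσT : ∀ j t, σ j (t + 2 * Real.pi) = σ j t + 2 * Real.pi := fun j t =>
    (H.isSlope j).flow_add_period (H.slope j).periodic _ _ _
  have hzT : ∀ t, exitTrace e v (t + 2 * Real.pi) = exitTrace e v t := fun t =>
    funext fun k => (H.reg k).periodic _ _
  have hET : ∀ j x t, E j (x, t + 2 * Real.pi) = E j (x, t) := fun j x t => by
    simp only [hEdef, (H.isSlope j).flow_add_period (H.slope j).periodic, (H.coeff j j).periodic]
  have hρT : ∀ j x t, ρ j (x, t + 2 * Real.pi) = ρ j (x, t) := fun j x t => by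
    have h1 := hv j x t
    have h2 := hv j x (t + 2 * Real.pi)
    have h3 := hET j x t
    simp only [hEdef] at h3
    rw [(H.isSlope j).flow_add_period (H.slope j).periodic, (H.reg j).periodic, hzT, H.periodic,
      h3] at h2
    linarith
  have hEσ : ∀ j t, E j (1 - e j, σ j t) =
      Real.exp (∫ η in (1 - e j)..(e j), β j j (η, flow (F j) η (1 - e j) t)) := fun j t => by
    simp only [hEdef, hσdef, (H.isSlope j).flow_flow, clamp_of_mem (H.exit_mem j)]
    rw [intervalIntegral.integral_symm, neg_neg]
  have hσd : ∀ j t, deriv (σ j) t = Real.exp (∫ η in (1 - e j)..(e j),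
      dt (F j) (η, flow (F j) η (1 - e j) t)) := fun j t => by
    rw [((H.isSlope j).hasDerivAt_flow (e j) (1 - e j) t).deriv, flowDeriv,
      clamp_of_mem (H.exit_mem j), clamp_of_mem (H.entry_mem j)]
  set Ψ : ι → ℝ × (ι → ℝ) → ℝ := fun j q =>
    E j (1 - e j, σ j q.1) * Φ j (σ j q.1, q.2) + ρ j (1 - e j, σ j q.1) with hΨdef
  have hΨ : ∀ j, ContDiff ℝ 1 (Ψ j) := fun j => by
    have hs : ContDiff ℝ 1 fun q : ℝ × (ι → ℝ) => σ j q.1 := (hσ j).comp contDiff_fst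
    exact ((((hE' j).contDiff (1 - e j)).comp hs).mul
      ((H.contDiff j).comp (hs.prodMk contDiff_snd))).add
      (((hρ j).contDiff (1 - e j)).comp hs)
  have hpart : ∀ j t y k, fderiv ℝ (Ψ j) (t, y) (0, Pi.single k 1) = E j (1 - e j, σ j t) *
      fderiv ℝ (fun y => Φ j (σ j t, y)) y (Pi.single k 1) := fun j t y k => by
    have h1 := (((hΨ j).differentiable one_ne_zero (t, y)).hasFDerivAt.comp y
      (hasFDerivAt_prodMk_right t y))
    have hd : DifferentiableAt ℝ (fun y => Φ j (σ j t, y)) y :=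
      ((H.contDiff j).differentiable one_ne_zero _).comp y
        (hasFDerivAt_prodMk_right (σ j t) y).differentiableAt
    have h2 := (hd.hasFDerivAt.const_mul (E j (1 - e j, σ j t))).add_const (ρ j (1 - e j, σ j t))
    have h3 := congrArg (fun L : (ι → ℝ) →L[ℝ] ℝ => L (Pi.single k 1)) (h1.unique h2)
    simpa using h3
  have hsum : ∀ j t y, ∑ k, |fderiv ℝ (Ψ j) (t, y) (0, Pi.single k 1)| =
      E j (1 - e j, σ j t) * ∑ k, |fderiv ℝ (fun y => Φ j (σ j t, y)) y (Pi.single k 1)| :=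
    fun j t y => by
    rw [Finset.mul_sum]
    refine Finset.sum_congr rfl fun k _ => ?_
    rw [hpart, abs_mul, abs_of_pos (Real.exp_pos _)]
  have hline : ∀ j t, Continuous fun η => (η, flow (F j) η (1 - e j) t) := fun j t =>
    continuous_id.prodMk ((H.isSlope j).continuous_flow_left _ _)
  refine contDiff_one_of_functional_eq Real.two_pi_pos hΨ hσ (fun j t y => ?_) hσT
    H.continuous_exitTrace hzT (fun t j => ?_) (fun j t y => ?_) fun j t y => ?_
  · simp only [hΨdef, hσT, hET, hρT, H.periodic]
  · have := hv j (1 - e j) (σ j t)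
    rw [hσdef, (H.isSlope j).flow_flow, (H.isSlope j).flow_self] at this
    exact this
  · have := H.contraction 0 (Nat.zero_le _) j t y
    simp only [Nat.cast_zero, zero_mul, add_zero] at this
    rwa [hsum, hEσ]
  · have := H.contraction 1 le_rfl j t y
    simp only [Nat.cast_one, one_mul] at this
    have hβi : IntervalIntegrable (fun η => β j j (η, flow (F j) η (1 - e j) t)) volume
        (1 - e j) (e j) := ((H.coeff j j).continuous.comp (hline j t)).intervalIntegrable _ _
    have hFi : IntervalIntegrable (fun η => dt (F j) (η, flow (F j) η (1 - e j) t)) volume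
        (1 - e j) (e j) := ((H.isSlope j).cont'.comp (hline j t)).intervalIntegrable _ _
    rw [intervalIntegral.integral_add hβi hFi, Real.exp_add] at this
    rw [hsum, hEσ, hσd, abs_of_pos (Real.exp_pos _), ← mul_assoc, mul_comm (Real.exp _)]
    exact this

/-- Every continuous solution has a continuous time derivative. -/
theorem timeC1 (H : IsDissipativeSolution 1 e F β G Φ v) (j : ι) : TimeC1 (v j) (dt (v j)) := by
  obtain ⟨ρ, ρ', hρ, hv⟩ := H.exists_timeC1_remainder j
  have hF := H.isSlope j
  have hE := ((((H.coeff_timeC1 j j).comp (hF.timeC1_flow (e j))).integral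
      (e j)).comp_space continuous_clamp).neg.exp
  have hb : ContDiff ℝ 1 fun t => Φ j (t, exitTrace e v t) :=
    (H.contDiff j).comp (contDiff_id.prodMk H.contDiff_exitTrace)
  have hΦ : TimeC1 (fun q => Φ j (q.2, exitTrace e v q.2))
      (fun q => deriv (fun t => Φ j (t, exitTrace e v t)) q.2) :=
    ⟨hb.continuous.comp continuous_snd, (hb.continuous_deriv le_rfl).comp continuous_snd,
      fun x t => (hb.differentiable one_ne_zero t).hasDerivAt⟩
  have h := ((hE.mul hΦ).add hρ).comp (hF.timeC1_flow_foot (e j))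
  have h' := h.congr (k := v j) fun q => by
    have := hv q.1 (flow (F j) (e j) q.1 q.2)
    rwa [hF.flow_flow, hF.flow_self] at this
  refine ⟨h'.cont, ?_, fun x t => (h'.hasDerivAt x t).differentiableAt.hasDerivAt⟩
  rw [show dt (v j) = _ from funext fun q => (h'.hasDerivAt q.1 q.2).deriv]
  exact h'.cont'

/-- The time derivative of a solution is a solution of a system of the same kind. The diagonal
coefficients of the system and the order of the contraction condition are shifted alike. -/
theorem dt (H : IsDissipativeSolution (s + 1) e F β G Φ v) (hv : ∀ j, Reg s (v j)) :
    IsDissipativeSolution s e F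
      (fun j k q => β j k q + if j = k then DissipativeHyperbolic.dt (F j) q else 0)
      (fun j q => DissipativeHyperbolic.dt (G j) q -
        ∑ k, DissipativeHyperbolic.dt (β j k) q * v k q)
      (fun j q => fderiv ℝ (Φ j) (q.1, exitTrace e v q.1) (1, q.2))
      (fun j => DissipativeHyperbolic.dt (v j)) := by
  have H1 : IsDissipativeSolution 1 e F β G Φ v := H.of_le (Nat.le_add_left 1 s)
  have hinf : ((s : WithTop ℕ∞) + 1) ≤ ∞ := by exact_mod_cast le_top
  have hz : ContDiff ℝ s (exitTrace e v) := contDiff_pi.2 fun k => by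
    refine contDiffOn_univ.1 ((hv k).contDiffOn.comp (t := strip) (s := univ)
      (f := fun t => (1 - e k, t)) (contDiff_const.prodMk contDiff_id).contDiffOn
      fun t _ => mem_strip.2 (H.exit_mem k))
  have hzT : ∀ t, exitTrace e v (t + 2 * Real.pi) = exitTrace e v t := fun t =>
    funext fun k => (H.reg k).periodic _ _
  have hΦd : ∀ j, Differentiable ℝ (Φ j) := fun j => (H1.contDiff j).differentiable one_ne_zero
  have hΦT : ∀ j t y, fderiv ℝ (Φ j) (t + 2 * Real.pi, y) = fderiv ℝ (Φ j) (t, y) := fun j t y => by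
    have e : Φ j = fun q => Φ j (q + (2 * Real.pi, 0)) := by
      ext ⟨s, x⟩; simp [H.periodic]
    conv_rhs => rw [e]
    rw [fderiv_comp_add_right]
    simp
  refine
    { entry := H.entry
      slope := H.slope
      coeff := fun j k => ?_
      source := fun j => ?_
      contDiff := fun j => ?_
      periodic := fun j t y => ?_
      levy := fun j k hjk => ?_
      contraction := fun l hl j t y => ?_
      reg := fun j => ?_
      transported := fun j => ?_
      boundary := fun j t => ?_ }
  · by_cases hjk : j = k
    · simpa only [hjk, if_true] using (H.coeff k k).add ((H.slope k).dt (by simp))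
    · simpa only [hjk, if_false, add_zero] using H.coeff j k
  · exact ((H.source j).dt (by simp)).sub
      (Reg.sum fun k _ => ((H.coeff j k).dt hinf).mul (hv k))
  · have h1 : ContDiff ℝ s fun q : ℝ × (ι → ℝ) => fderiv ℝ (Φ j) (q.1, exitTrace e v q.1) :=
      ((H.contDiff j).fderiv_right (m := s) (by simp)).comp
        (contDiff_fst.prodMk (hz.comp contDiff_fst))
    exact h1.clm_apply (contDiff_const.prodMk contDiff_snd)
  · simp only [hzT, hΦT]
  · simpa only [hjk, if_false, add_zero] using H.levy j k hjk
  · have h := H.contraction (l + 1) (Nat.succ_le_succ hl) j t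
      (exitTrace e v (flow (F j) (e j) (1 - e j) t))
    have hint : ∀ q, β j j q + DissipativeHyperbolic.dt (F j) q +
        l * DissipativeHyperbolic.dt (F j) q =
        β j j q + ((l + 1 : ℕ) : ℝ) * DissipativeHyperbolic.dt (F j) q := fun q => by
      push_cast; ring
    simp only [if_true, hint]
    set τ := flow (F j) (e j) (1 - e j) t
    convert h using 5
    -- the new boundary operator is affine in `y`, its linear part being a differential of `Φ j`
    have e1 : HasFDerivAt (fun y : ι → ℝ => fderiv ℝ (Φ j) (τ, exitTrace e v τ) (1, y))
        ((fderiv ℝ (Φ j) (τ, exitTrace e v τ)).comp (ContinuousLinearMap.inr ℝ ℝ (ι → ℝ))) y :=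
      (fderiv ℝ (Φ j) (τ, exitTrace e v τ)).hasFDerivAt.comp y (hasFDerivAt_prodMk_right 1 y)
    have e2 := (hΦd j (τ, exitTrace e v τ)).hasFDerivAt.comp (exitTrace e v τ)
      (hasFDerivAt_prodMk_right τ (exitTrace e v τ))
    rw [e1.fderiv]
    exact e2.fderiv.symm
  · exact ⟨contDiffOn_zero.2 (H1.timeC1 j).cont'.continuousOn, dt_clamp (H.reg j).clamp_eq,
      dt_periodic (H.reg j).periodic⟩
  · have hq := ((H1.source j).timeC1 le_rfl).sub (TimeC1.sum (s := Finset.univ)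
      fun k _ => (H1.coeff_timeC1 j k).mul (H1.timeC1 k))
    have h := (H.transported j).deriv (H.isSlope j) (H1.timeC1 j) hq
    intro w hw ξ hξ
    refine (h w hw ξ hξ).congr_deriv ?_
    simp only [slopeRhs, add_mul, ite_mul, zero_mul, Finset.sum_add_distrib, Finset.sum_ite_eq,
      Finset.mem_univ, if_true]
    ring
  · have h1 := (H1.timeC1 j).hasDerivAt (e j) t
    have hzd : HasDerivAt (exitTrace e v)
        (exitTrace e (fun j => DissipativeHyperbolic.dt (v j)) t) t :=
      hasDerivAt_pi.2 fun k => (H1.timeC1 k).hasDerivAt (1 - e k) t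
    have h2 := (hΦd j (t, exitTrace e v t)).hasFDerivAt.comp_hasDerivAt t
      ((hasDerivAt_id t).prodMk hzd)
    refine h1.unique (h2.congr_of_eventuallyEq (Eventually.of_forall fun t => ?_))
    exact H.boundary j t

/-- Continuous solutions are as regular as the data and the order of the contraction permit. -/
theorem contDiffOn (H : IsDissipativeSolution s e F β G Φ v) (j : ι) :
    ContDiffOn ℝ s (v j) strip := by
  induction s generalizing β G Φ v j with
  | zero => simpa using (H.reg j).contDiffOn
  | succ s ih =>
    have hle : (s : WithTop ℕ∞) ≤ ∞ := by exact_mod_cast le_top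
    have hv : ∀ j, Reg s (v j) := fun j =>
      ⟨ih (H.of_le (Nat.le_succ s)) j, (H.reg j).clamp_eq, (H.reg j).periodic⟩
    have H1 : IsDissipativeSolution 1 e F β G Φ v := H.of_le (Nat.le_add_left 1 s)
    have hq : ContDiffOn ℝ s (slopeRhs β G v j) strip :=
      ((H.of_le (Nat.le_succ s)).source j).contDiffOn.sub
        (ContDiffOn.sum fun k _ => ((H.coeff j k).contDiffOn.of_le hle).mul (hv k).contDiffOn)
    have := (H.transported j).contDiffOn_succ (H.isSlope j) (H1.timeC1 j)
      ((H.slope j).contDiffOn.of_le hle) hq (ih (H.dt hv) j)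
    exact_mod_cast this

end IsDissipativeSolution

/-! ### Reduction of the reflection problem to the normalized system -/

theorem Reg.of_periodicInTime {s : WithTop ℕ∞} {g : ℝ × ℝ → ℝ} (hg : ContDiffOn ℝ s g strip)
    (hp : PeriodicInTime g) : Reg s fun q => g (clamp q.1, q.2) :=
  ⟨hg.congr fun q hq => by simp only [clamp_of_mem (mem_strip.1 hq)],
    fun x t => by simp only [clamp_clamp], fun x t => hp _ (clamp_mem x) t⟩

theorem omega_eq_flow {F F' α : ℝ × ℝ → ℝ} (hF : IsSlope F F') (hα : ∀ q ∈ strip, F q = 1 / α q)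
    {ξ x : ℝ} (hξ : ξ ∈ Icc (0 : ℝ) 1) (hx : x ∈ Icc (0 : ℝ) 1) (t : ℝ) :
    omega α ξ x t = flow F ξ x t := by
  have hiff : ∀ w, IsCharacteristic α x t w ↔ w x = t ∧ IsIntegral F w := fun w => by
    refine and_congr_right fun _ => forall₂_congr fun ξ hξ => ?_
    rw [hα _ (mem_strip.2 hξ)]
  have he : ∃ w, IsCharacteristic α x t w :=
    ⟨_, (hiff _).2 ⟨hF.flow_self x t, hF.isIntegral_flow x t⟩⟩
  obtain ⟨h1, h2⟩ := (hiff _).1 he.choose_spec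
  rw [omega, dif_pos he, ← hF.flow_eq h2 hx hξ, h1]

/-- The representation formula along the characteristics implies the differential equation. -/
theorem hasDerivWithinAt_of_representation {y β g : ℝ → ℝ} (hβ : Continuous β) (hg : Continuous g)
    {e y₀ : ℝ} (hy : ∀ x ∈ Icc (0 : ℝ) 1, y x = Real.exp (∫ η in x..e, β η) * y₀ +
      ∫ ξ in e..x, Real.exp (∫ η in x..ξ, β η) * g ξ) {x : ℝ} (hx : x ∈ Icc (0 : ℝ) 1) :
    HasDerivWithinAt y (g x - β x * y x) (Icc 0 1) x := by
  have hB : ∀ x, HasDerivAt (fun x => ∫ η in e..x, β η) (β x) x := fun x =>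
    intervalIntegral.integral_hasDerivAt_right (hβ.intervalIntegrable _ _)
      (hβ.stronglyMeasurableAtFilter _ _) hβ.continuousAt
  have hBc : Continuous fun x => ∫ η in e..x, β η :=
    continuous_iff_continuousAt.2 fun x => (hB x).continuousAt
  have hEg : Continuous fun ξ => Real.exp (∫ η in e..ξ, β η) * g ξ := hBc.rexp.mul hg
  have hy' : ∀ x ∈ Icc (0 : ℝ) 1, y x = Real.exp (-∫ η in e..x, β η) *
      (y₀ + ∫ ξ in e..x, Real.exp (∫ η in e..ξ, β η) * g ξ) := fun x hx => by
    rw [hy x hx, mul_add, ← intervalIntegral.integral_symm e x,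
      ← intervalIntegral.integral_const_mul]
    congr 1
    refine intervalIntegral.integral_congr fun ξ _ => ?_
    rw [← mul_assoc, ← Real.exp_add, intervalIntegral.integral_add_adjacent_intervals
      (hβ.intervalIntegrable _ _) (hβ.intervalIntegrable _ _)]
  have h := (hB x).neg.exp.mul ((intervalIntegral.integral_hasDerivAt_right
    (hEg.intervalIntegrable e x) (hEg.stronglyMeasurableAtFilter _ _)
    hEg.continuousAt).const_add y₀)
  refine (h.hasDerivWithinAt.congr_of_mem hy' hx).congr_deriv ?_
  have h1 : Real.exp (-∫ η in e..x, β η) * Real.exp (∫ η in e..x, β η) = 1 := by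
    rw [← Real.exp_add, neg_add_cancel, Real.exp_zero]
  rw [hy' x hx]
  simp only [Pi.neg_apply]
  linear_combination g x * h1

/-- In terms of `F_j = 1 / a_j`, `β_jk = b_jk / a_j` and `G_j = f_j / a_j`, a continuous solution of
the reflection problem solves a system of the form solved for the space derivatives. -/
theorem isDissipativeSolution {n : ℕ} (m r : ℕ)
    {a : Fin n → ℝ × ℝ → ℝ} {b : Fin n → Fin n → ℝ × ℝ → ℝ} {f : Fin n → ℝ × ℝ → ℝ}
    {h : Fin n → (Fin n → ℝ) → ℝ}
    (ha : ∀ j, SmoothOnStrip (a j)) (hb : ∀ j k, SmoothOnStrip (b j k))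
    (hf : ∀ j, SmoothOnStrip (f j)) (hh : ∀ j, ContDiff ℝ ∞ (h j))
    (ha_per : ∀ j, PeriodicInTime (a j)) (hb_per : ∀ j k, PeriodicInTime (b j k))
    (hf_per : ∀ j, PeriodicInTime (f j)) (hsign : SignCondition m a) (hlevy : LevyCondition a b)
    (hcontr : ∀ l : ℕ, l ≤ r → Contraction m a b h l)
    {u : ℝ × ℝ → Fin n → ℝ} (hu : IsContinuousSolution m a b f h u) (hu_per : PeriodicInTime u) :
    IsDissipativeSolution r (entry m) (fun j q => 1 / a j (clamp q.1, q.2))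
      (fun j k q => b j k (clamp q.1, q.2) / a j (clamp q.1, q.2))
      (fun j q => f j (clamp q.1, q.2) / a j (clamp q.1, q.2)) (fun j q => h j q.2)
      (fun j q => u (clamp q.1, q.2) j) := by
  set F : Fin n → ℝ × ℝ → ℝ := fun j q => 1 / a j (clamp q.1, q.2)
  set β : Fin n → Fin n → ℝ × ℝ → ℝ := fun j k q => b j k (clamp q.1, q.2) / a j (clamp q.1, q.2)
  set G : Fin n → ℝ × ℝ → ℝ := fun j q => f j (clamp q.1, q.2) / a j (clamp q.1, q.2)
  set v : Fin n → ℝ × ℝ → ℝ := fun j q => u (clamp q.1, q.2) j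
  have ha0 : ∀ j, ∀ q ∈ strip, a j q ≠ 0 := fun j q hq => by
    rcases lt_or_ge (j : ℕ) m with hj | hj
    · exact ((hsign j q hq).1 hj).ne'
    · exact ((hsign j q hq).2 hj).ne
  have hFr : ∀ j, Reg ∞ (F j) := fun j => Reg.of_periodicInTime (g := fun q => 1 / a j q)
    (contDiffOn_const.div (ha j) (ha0 j)) fun x hx t => by simp only [ha_per j x hx t]
  have hβr : ∀ j k, Reg ∞ (β j k) := fun j k => Reg.of_periodicInTime
    (g := fun q => b j k q / a j q) ((hb j k).div (ha j) (ha0 j)) fun x hx t => by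
      simp only [ha_per j x hx t, hb_per j k x hx t]
  have hGr : ∀ j, Reg ∞ (G j) := fun j => Reg.of_periodicInTime
    (g := fun q => f j q / a j q) ((hf j).div (ha j) (ha0 j)) fun x hx t => by
      simp only [ha_per j x hx t, hf_per j x hx t]
  have hvr : ∀ j, Reg 0 (v j) := fun j => Reg.of_periodicInTime (g := fun q => u q j)
    (contDiffOn_zero.2 (continuousOn_pi.1 hu.1 j)) fun x hx t => by simp only [hu_per x hx t]
  have hF : ∀ j, IsSlope (F j) (dt (F j)) := fun j => (hFr j).isSlope
  have hω : ∀ j, ∀ ξ ∈ Icc (0 : ℝ) 1, ∀ x ∈ Icc (0 : ℝ) 1, ∀ t,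
      omega (a j) ξ x t = flow (F j) ξ x t := fun j ξ hξ x hx t =>
    omega_eq_flow (hF j) (fun q hq => by simp only [F, clamp_of_mem (mem_strip.1 hq)]) hξ hx t
  have hentry : ∀ j : Fin n, entry m j = 0 ∨ entry m j = 1 := fun j => by
    unfold entry; split_ifs <;> simp
  have hentry_mem : ∀ j : Fin n, entry m j ∈ Icc (0 : ℝ) 1 := fun j => by
    rcases hentry j with h | h <;> rw [h] <;> norm_num
  have hexit_mem : ∀ j : Fin n, 1 - entry m j ∈ Icc (0 : ℝ) 1 := fun j => by
    rcases hentry j with h | h <;> rw [h] <;> norm_num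
  have htrace : ∀ t, exitTrace (entry m) v t = outgoing m u t := fun t => funext fun k => by
    have h1 : exitTrace (entry m) v t k = u (1 - entry m k, t) k := by
      simp only [exitTrace, v, clamp_of_mem (hexit_mem k)]
    rw [h1, outgoing, entry]
    split_ifs <;> simp
  have hdtF : ∀ j, ∀ η ∈ Icc (0 : ℝ) 1, ∀ t, dt (F j) (η, t) = -(dt (a j) (η, t) / a j (η, t) ^ 2) :=
    fun j η hη t => by
    have h1 := (timeC1_clamp ((ha j).of_le (by norm_num))).hasDerivAt η t
    simp only [clamp_of_mem hη] at h1
    have h2 := h1.inv (ha0 j _ (mem_strip.2 hη))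
    have h3 : dt (a j) (η, t) = _ := h1.deriv
    have h4 : dt (F j) (η, t) = deriv (fun s => a j (η, s))⁻¹ t := by
      simp only [dt, F, clamp_of_mem hη, one_div]
      rfl
    rw [h4, h2.deriv, h3, neg_div]
  refine
    { entry := hentry
      slope := hFr
      coeff := hβr
      source := fun j => (hGr j).of_le (by exact_mod_cast le_top)
      contDiff := fun j => ((hh j).of_le (by exact_mod_cast le_top)).comp contDiff_snd
      periodic := fun j t y => rfl
      levy := fun j k hjk => ?_
      contraction := fun l hl j t y => ?_
      reg := hvr
      transported := fun j w hw ξ hξ => ?_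
      boundary := fun j t => ?_ }
  · obtain ⟨p, hp, hpb, -⟩ := hlevy j k hjk
    refine ⟨fun q => p q * a k q, hp.mul ((ha k).of_le (by norm_num)), fun q hq => ?_⟩
    have h1 := ha0 j q hq
    have h2 := ha0 k q hq
    simp only [β, F, clamp_of_mem (mem_strip.1 hq), hpb q hq]
    field_simp
  · have h1 := hcontr l hl j (1 - entry m j) (hexit_mem j) t y
    convert h1 using 3
    refine intervalIntegral.integral_congr fun η hη => ?_
    have hη' := uIcc_subset_unit (hexit_mem j) (hentry_mem j) hη
    simp only [hω j η hη' _ (hexit_mem j), hdtF j η hη', β, clamp_of_mem hη']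
    ring
  · -- the representation formula on the characteristic entering at the time `s`
    set s := w (entry m j)
    have hwf : ∀ x ∈ Icc (0 : ℝ) 1, w x = flow (F j) x (entry m j) s := fun x hx =>
      ((hF j).flow_eq hw (hentry_mem j) hx).symm
    have hcurve : Continuous fun x => (x, flow (F j) x (entry m j) s) :=
      continuous_id.prodMk ((hF j).continuous_flow_left _ _)
    have hωs : ∀ x ∈ Icc (0 : ℝ) 1, ∀ η ∈ Icc (0 : ℝ) 1,
        omega (a j) η x (flow (F j) x (entry m j) s) = flow (F j) η (entry m j) s :=
      fun x hx η hη => by rw [hω j η hη x hx, (hF j).flow_flow]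
    have hβc : Continuous fun x => β j j (x, flow (F j) x (entry m j) s) :=
      (hβr j j).continuous.comp hcurve
    have hGc : Continuous fun x => G j (x, flow (F j) x (entry m j) s) :=
      (hGr j).continuous.comp hcurve
    have hSc : Continuous fun x => ∑ k ∈ Finset.univ.erase j,
        β j k (x, flow (F j) x (entry m j) s) * v k (x, flow (F j) x (entry m j) s) :=
      continuous_finsetSum _ fun k _ => ((hβr j k).continuous.comp hcurve).mul
        ((hvr k).continuous.comp hcurve)
    have hc : ∀ x ∈ Icc (0 : ℝ) 1, ∀ ξ ∈ Icc (0 : ℝ) 1,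
        c a b j ξ x (flow (F j) x (entry m j) s) =
          Real.exp (∫ η in x..ξ, β j j (η, flow (F j) η (entry m j) s)) := fun x hx ξ hξ => by
      rw [c]
      congr 1
      refine intervalIntegral.integral_congr fun η hη => ?_
      have hη' := uIcc_subset_unit hx hξ hη
      simp only [hωs x hx η hη', β, clamp_of_mem hη']
    have hrep : ∀ x ∈ Icc (0 : ℝ) 1, v j (x, flow (F j) x (entry m j) s) =
        Real.exp (∫ η in x..(entry m j), β j j (η, flow (F j) η (entry m j) s)) *
          h j (outgoing m u s) + ∫ ξ in (entry m j)..x,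
            Real.exp (∫ η in x..ξ, β j j (η, flow (F j) η (entry m j) s)) *
            (G j (ξ, flow (F j) ξ (entry m j) s) - ∑ k ∈ Finset.univ.erase j,
              β j k (ξ, flow (F j) ξ (entry m j) s) * v k (ξ, flow (F j) ξ (entry m j) s)) :=
      fun x hx => by
      have hEc : Continuous fun ξ =>
          Real.exp (∫ η in x..ξ, β j j (η, flow (F j) η (entry m j) s)) :=
        (intervalIntegral.continuous_primitive (fun _ _ => hβc.intervalIntegrable _ _) x).rexp
      have h1 := hu.2 j x hx (flow (F j) x (entry m j) s)
      rw [hωs x hx _ (hentry_mem j), (hF j).flow_self, hc x hx _ (hentry_mem j), sub_add] at h1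
      have hvx : v j (x, flow (F j) x (entry m j) s) = u (x, flow (F j) x (entry m j) s) j := by
        simp only [v, clamp_of_mem hx]
      have hint := intervalIntegral.integral_sub (μ := volume) (a := entry m j) (b := x)
        ((hEc.mul hGc).intervalIntegrable _ _) ((hEc.mul hSc).intervalIntegrable _ _)
      simp only [Pi.mul_apply] at hint
      rw [hvx, h1, sub_eq_add_neg]
      congr 1
      simp only [mul_sub]
      rw [hint, neg_sub]
      congr 1
      · refine intervalIntegral.integral_congr fun ξ hξ => ?_
        have hξ' := uIcc_subset_unit (hentry_mem j) hx hξ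
        simp only [d, hc x hx ξ hξ', hωs x hx ξ hξ', G, clamp_of_mem hξ']
        ring
      · refine intervalIntegral.integral_congr fun ξ hξ => ?_
        have hξ' := uIcc_subset_unit (hentry_mem j) hx hξ
        simp only [d, hc x hx ξ hξ', hωs x hx ξ hξ', β, v, clamp_of_mem hξ', Finset.mul_sum]
        refine Finset.sum_congr rfl fun k _ => ?_
        ring
    have hder := hasDerivWithinAt_of_representation hβc (hGc.sub hSc)
      (y := fun x => v j (x, flow (F j) x (entry m j) s)) hrep hξ
    have hval : ∀ x ∈ Icc (0 : ℝ) 1, v j (x, w x) = v j (x, flow (F j) x (entry m j) s) :=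
      fun x hx => by rw [hwf x hx]
    refine (hder.congr_of_mem hval hξ).congr_deriv ?_
    rw [slopeRhs, ← Finset.add_sum_erase _ _ (Finset.mem_univ j), hwf ξ hξ]
    simp only [Pi.sub_apply]
    ring
  · have h1 := hu.2 j (entry m j) (hentry_mem j) t
    simp only [intervalIntegral.integral_same, sub_zero, add_zero, c, Real.exp_zero, one_mul,
      hω j _ (hentry_mem j) _ (hentry_mem j), (hF j).flow_self] at h1
    simp only [v, clamp_of_mem (hentry_mem j), h1, htrace]

end DissipativeHyperbolic

end

theorem theorem2p3 (n m r : ℕ) (hm : m ≤ n)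
    (a : Fin n → ℝ × ℝ → ℝ) (b : Fin n → Fin n → ℝ × ℝ → ℝ) (f : Fin n → ℝ × ℝ → ℝ)
    (h : Fin n → (Fin n → ℝ) → ℝ)
    (ha : ∀ j, DissipativeHyperbolic.SmoothOnStrip (a j))
    (hb : ∀ j k, DissipativeHyperbolic.SmoothOnStrip (b j k))
    (hf : ∀ j, DissipativeHyperbolic.SmoothOnStrip (f j))
    (hh : ∀ j, ContDiff ℝ ∞ (h j))
    (ha_per : ∀ j, DissipativeHyperbolic.PeriodicInTime (a j))
    (hb_per : ∀ j k, DissipativeHyperbolic.PeriodicInTime (b j k))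
    (hf_per : ∀ j, DissipativeHyperbolic.PeriodicInTime (f j))
    (hsign : DissipativeHyperbolic.SignCondition m a)
    (hnd : DissipativeHyperbolic.NonDegenerate a)
    (hlevy : DissipativeHyperbolic.LevyCondition a b)
    (hcontr : ∀ l : ℕ, l ≤ r → DissipativeHyperbolic.Contraction m a b h l)
    (u : ℝ × ℝ → Fin n → ℝ)
    (hu : DissipativeHyperbolic.IsContinuousSolution m a b f h u)
    (hu_per : DissipativeHyperbolic.PeriodicInTime u) :
    ContDiffOn ℝ r u DissipativeHyperbolic.strip := by
  have H := DissipativeHyperbolic.isDissipativeSolution m r ha hb hf hh ha_per hb_per hf_per hsign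
    hlevy hcontr hu hu_per
  refine contDiffOn_pi.2 fun j => (H.contDiffOn j).congr fun q hq => ?_
  rw [DissipativeHyperbolic.clamp_of_mem (DissipativeHyperbolic.mem_strip.1 hq)]
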